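/- Let $N\ge 3$, let $\Omega\subset\mathbb{R}^N$ be open and let $1<p<\infty$, $p'=p/(p-1)$. Let $W^{1,2}_0(\Omega)$ be the closure of $C^\infty_0(\Omega)$ in the norm $\|\nabla u\|_{L^2(\Omega)}$ (a space of functions in $L^{2^*}(\Omega)$, $2^*=2N/(N-2)$), let $W^{-1,2}(\Omega)$ be its dual, and let $f\in W^{-1,2}(\Omega)$, $f\neq 0$. Put $$T_N=\inf\Big\{\int_{\mathbb{R}^N}|\nabla v|^2\,dx : v\in W^{1,2}_0(\mathbb{R}^N),\ \|v\|_{L^{2^*}(\mathbb{R}^N)}=1\Big\},$$ let $\mathcal V$ be the set of Borel functions $V:\Omega\to(-\infty,+\infty]$ with $\|V_-\|_{L^{N/2}(\Omega)}<T_N$, where $V_-$ is the negative part of $V$, and for $V\in\mathcal V$ let $$\mathcal E_f(V)=\inf_{u\in W^{1,2}_0(\Omega)}\ \frac12\int_\Omega|\nabla u|^2\,dx+\frac12\int_\Omega V u^2\,dx-\langle f,u\rangle .$$ Then $\mathcal E_f(V)$ is finite for every $V\in\mathcal V$ with $\|V\|_{L^p(\Omega)}\le1$. The functional $$G_{p,f}(u)=\frac12\int_\Omega|\nabla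 u|^2\,dx+\frac12\Big(\int_\Omega|u|^{2p/(p-1)}\,dx\Big)^{(p-1)/p}-\langle f,u\rangle$$ (with value $+\infty$ if $u\notin L^{2p/(p-1)}(\Omega)$) has a unique minimiser $v_0$ on $W^{1,2}_0(\Omega)$, and $c_1:=\|v_0\|_{L^{2p/(p-1)}(\Omega)}\in(0,\infty)$. The problem $$\max\{\mathcal E_f(V) : V\in\mathcal V,\ \|V\|_{L^p(\Omega)}\le 1\}$$ has a solution $V_0$, unique up to equality almost everywhere, and $V_0\ge0$ almost everywhere. Moreover there are constants $\sigma'_M>0$ and $\sigma''_M>0$, depending only on $p$ and $c_1$, such that for every $V\in\mathcal V$ with $\|V\|_{L^p(\Omega)}\le 1$ $$\mathcal E_f(V_0)-\mathcal E_f(V)\ \ge\ \sigma'_M\,\big\||V|^{p-2}V-V_0^{p-1}\big\|^2_{L^{p'}(\Omega)}\qquad\text{if } p\ge2,$$ $$\mathcal E_f(V_0)-\mathcal E_f(V)\ \ge\ \sigma''_M\,\|V-V_0\|^2_{L^{p}(\Omega)}\qquad\text{if } 1<p<2.$$ -/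

import Mathlib

open MeasureTheory Set
open scoped ENNReal

noncomputable section

namespace SchrodingerPotential

/-- The Euclidean space `ℝ^N`. -/
abbrev Eucl (N : ℕ) : Type := EuclideanSpace ℝ (Fin N)

/-- The Sobolev exponent `2^* = 2N/(N-2)`, for `N ≥ 3`. -/
def sobolevExp (N : ℕ) : ℝ≥0∞ := ENNReal.ofReal (2 * (N : ℝ) / ((N : ℝ) - 2))

theorem one_le_sobolevExp (N : ℕ) (hN : 3 ≤ N) : 1 ≤ sobolevExp N := by
  have h : (3 : ℝ) ≤ N := by exact_mod_cast hN
  rw [sobolevExp, ENNReal.one_le_ofReal, le_div_iff₀ (by linarith)]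
  linarith

instance instFactOneLeSobolevExp (N : ℕ) [hN : Fact (3 ≤ N)] : Fact (1 ≤ sobolevExp N) :=
  ⟨one_le_sobolevExp N hN.out⟩

/-- Lebesgue measure on `Ω`. Functions on `Ω` are written as functions on `ℝ^N`, seen through
this measure only. -/
abbrev vol {N : ℕ} (Ω : Set (Eucl N)) : Measure (Eucl N) := volume.restrict Ω

/-- The ambient space `L^{2^*}(Ω) × L^2(Ω; ℝ^N)` of pairs (function, gradient). -/
abbrev PairSpace {N : ℕ} [Fact (3 ≤ N)] (Ω : Set (Eucl N)) : Type :=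
  Lp ℝ (sobolevExp N) (vol Ω) × Lp (Eucl N) 2 (vol Ω)

/-- The space of test functions `C^∞_0(Ω)`, embedded by `φ ↦ (φ, ∇φ)`. -/
def testPairs {N : ℕ} [Fact (3 ≤ N)] (Ω : Set (Eucl N)) : Submodule ℝ (PairSpace Ω) where
  carrier := {w | ∃ φ : Eucl N → ℝ, ContDiff ℝ ((⊤ : ℕ∞) : WithTop ℕ∞) φ ∧ HasCompactSupport φ ∧ tsupport φ ⊆ Ω ∧
    w.1 =ᵐ[vol Ω] φ ∧ w.2 =ᵐ[vol Ω] gradient φ}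
  zero_mem' := by
    refine ⟨0, contDiff_const, HasCompactSupport.zero, ?_, Lp.coeFn_zero _ _ _, ?_⟩
    · simp [tsupport]
    · have h : gradient (0 : Eucl N → ℝ) = 0 := by
        funext x
        simp [gradient]
      rw [h]
      exact Lp.coeFn_zero _ _ _
  add_mem' := by
    rintro w z ⟨φ, hφ, hcφ, hsφ, h1, h2⟩ ⟨ψ, hψ, hcψ, hsψ, h3, h4⟩
    refine ⟨φ + ψ, hφ.add hψ, hcφ.add hcψ,
      (tsupport_add φ ψ).trans (union_subset hsφ hsψ),
      (Lp.coeFn_add w.1 z.1).trans (h1.add h3), (Lp.coeFn_add w.2 z.2).trans ?_⟩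
    filter_upwards [h2, h4] with x hx hx'
    have e : fderiv ℝ (φ + ψ) x = fderiv ℝ φ x + fderiv ℝ ψ x :=
      fderiv_add (hφ.differentiable (by simp) x) (hψ.differentiable (by simp) x)
    simp [hx, hx', gradient, e]
  smul_mem' := by
    rintro c w ⟨φ, hφ, hcφ, hsφ, h1, h2⟩
    refine ⟨c • φ, hφ.const_smul c, hcφ.smul_left (f := fun _ => c),
      (closure_mono (Function.support_const_smul_subset c φ)).trans hsφ,
      (Lp.coeFn_smul c w.1).trans (h1.const_smul c), (Lp.coeFn_smul c w.2).trans ?_⟩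
    filter_upwards [h2] with x hx
    have e : fderiv ℝ (c • φ) x = c • fderiv ℝ φ x :=
      fderiv_const_smul (hφ.differentiable (by simp) x) c
    simp [hx, gradient, e]

/-- The homogeneous Sobolev space `W^{1,2}_0(Ω)`, `N ≥ 3`: the closure of `C^∞_0(Ω)` in the norm
`‖∇u‖_{L^2(Ω)}`. By Sobolev's inequality a sequence of test functions which is Cauchy in that norm
converges in `L^{2^*}(Ω)` too, so the elements of the closure are exactly the limits of pairs
`(φ, ∇φ)` in `L^{2^*}(Ω) × L^2(Ω; ℝ^N)`. -/
def W012 {N : ℕ} [Fact (3 ≤ N)] (Ω : Set (Eucl N)) : Submodule ℝ (PairSpace Ω) :=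
  (testPairs Ω).topologicalClosure

/-- The function `u ∈ L^{2^*}(Ω)` underlying an element of `W^{1,2}_0(Ω)`. -/
def fnOf {N : ℕ} [Fact (3 ≤ N)] {Ω : Set (Eucl N)} (u : W012 Ω) :
    Lp ℝ (sobolevExp N) (vol Ω) := u.1.1

/-- The gradient `∇u ∈ L^2(Ω; ℝ^N)` of an element of `W^{1,2}_0(Ω)`. -/
def gradOf {N : ℕ} [Fact (3 ≤ N)] {Ω : Set (Eucl N)} (u : W012 Ω) :
    Lp (Eucl N) 2 (vol Ω) := u.1.2

/-- `f` belongs to `W^{-1,2}(Ω)`: it is bounded with respect to the norm `‖∇u‖_{L^2(Ω)}`. The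
duality pairing `⟨f, u⟩` is then `f u`. -/
def MemDual {N : ℕ} [Fact (3 ≤ N)] {Ω : Set (Eucl N)} (f : W012 Ω →ₗ[ℝ] ℝ) : Prop :=
  ∃ C : ℝ, ∀ u : W012 Ω, |f u| ≤ C * ‖gradOf u‖

/-- The sharp Sobolev constant
`T_N = inf { ∫ |∇v|^2 : v ∈ W^{1,2}_0(ℝ^N), ‖v‖_{L^{2^*}(ℝ^N)} = 1 }`. -/
def sobolevConst (N : ℕ) [Fact (3 ≤ N)] : ℝ≥0∞ :=
  ⨅ (v : W012 (univ : Set (Eucl N))) (_ : ‖fnOf v‖ = 1), ENNReal.ofReal (‖gradOf v‖ ^ 2)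

/-- Positive part `V_+` of a potential. -/
def posPot {N : ℕ} (V : Eucl N → EReal) (x : Eucl N) : ℝ≥0∞ := (V x).toENNReal

/-- Negative part `V_-` of a potential. -/
def negPot {N : ℕ} (V : Eucl N → EReal) (x : Eucl N) : ℝ≥0∞ := (-V x).toENNReal

/-- The class of potentials `V : Ω → (-∞, +∞]`, Borel measurable, `‖V_-‖_{L^{N/2}(Ω)} < T_N`. -/
def Admissible {N : ℕ} [Fact (3 ≤ N)] (Ω : Set (Eucl N)) (V : Eucl N → EReal) : Prop :=
  Measurable V ∧ (∀ x, V x ≠ ⊥) ∧ eLpNorm (negPot V) ((N : ℝ≥0∞) / 2) (vol Ω) < sobolevConst N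

/-- `½ ∫ |∇u|^2 + ½ ∫ V u^2 - ⟨f, u⟩`, with value `+∞` when `∫ V_+ u^2 = +∞` (for an admissible
potential `∫ V_- u^2` is always finite). -/
def energyFunctional {N : ℕ} [Fact (3 ≤ N)] {Ω : Set (Eucl N)} (f : W012 Ω →ₗ[ℝ] ℝ)
    (V : Eucl N → EReal) (u : W012 Ω) : EReal :=
  ((1 / 2 * ‖gradOf u‖ ^ 2 - f u : ℝ) : EReal)
    + ((2⁻¹ * ∫⁻ x, posPot V x * ‖fnOf u x‖ₑ ^ 2 ∂(vol Ω) : ℝ≥0∞) : EReal)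
    - ((2⁻¹ * ∫⁻ x, negPot V x * ‖fnOf u x‖ₑ ^ 2 ∂(vol Ω) : ℝ≥0∞) : EReal)

/-- The energy `E_f(V)`, the infimum (attained, for admissible `V`) of `energyFunctional f V`
over `W^{1,2}_0(Ω)`. -/
def energy {N : ℕ} [Fact (3 ≤ N)] {Ω : Set (Eucl N)} (f : W012 Ω →ₗ[ℝ] ℝ)
    (V : Eucl N → EReal) : EReal :=
  ⨅ u : W012 Ω, energyFunctional f V u

/-- The norm `‖V‖_{L^p(Ω)}` of an extended real valued potential. -/
def potNorm {N : ℕ} (Ω : Set (Eucl N)) (p : ℝ) (V : Eucl N → EReal) : ℝ≥0∞ :=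
  eLpNorm (fun x => (V x).abs) (ENNReal.ofReal p) (vol Ω)

/-- `V₀` solves `max { E_f(V) : V admissible, ‖V‖_{L^p(Ω)} ≤ 1 }`. -/
def IsMaximalPotential {N : ℕ} [Fact (3 ≤ N)] {Ω : Set (Eucl N)} (p : ℝ) (f : W012 Ω →ₗ[ℝ] ℝ)
    (V₀ : Eucl N → EReal) : Prop :=
  Admissible Ω V₀ ∧ potNorm Ω p V₀ ≤ 1 ∧
    ∀ V : Eucl N → EReal, Admissible Ω V → potNorm Ω p V ≤ 1 → energy f V ≤ energy f V₀

/-- The norm `‖u‖_{L^{2p/(p-1)}(Ω)}`, equal to `+∞` if `u` is not in this space. -/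
def dualNorm {N : ℕ} [Fact (3 ≤ N)] {Ω : Set (Eucl N)} (p : ℝ) (u : W012 Ω) : ℝ≥0∞ :=
  eLpNorm (fnOf u : Eucl N → ℝ) (ENNReal.ofReal (2 * p / (p - 1))) (vol Ω)

/-- `G_{p,f}(u) = ½ ∫ |∇u|^2 + ½ (∫ |u|^{2p/(p-1)})^{(p-1)/p} - ⟨f, u⟩`, equal to `+∞` if `u` is
not in `L^{2p/(p-1)}(Ω)`. -/
def functionalG {N : ℕ} [Fact (3 ≤ N)] {Ω : Set (Eucl N)} (p : ℝ) (f : W012 Ω →ₗ[ℝ] ℝ)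
    (u : W012 Ω) : EReal :=
  ((1 / 2 * ‖gradOf u‖ ^ 2 - f u : ℝ) : EReal) + ((2⁻¹ * dualNorm p u ^ 2 : ℝ≥0∞) : EReal)

/-- `v₀` minimises `G_{p,f}` over `W^{1,2}_0(Ω)`. -/
def IsMinimizerG {N : ℕ} [Fact (3 ≤ N)] {Ω : Set (Eucl N)} (p : ℝ) (f : W012 Ω →ₗ[ℝ] ℝ)
    (v₀ : W012 Ω) : Prop :=
  ∀ u : W012 Ω, functionalG p f v₀ ≤ functionalG p f u

end SchrodingerPotential

end

open SchrodingerPotential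

noncomputable section

namespace SchrodingerPotential

open Filter Topology

section

section Lp

variable {α E : Type*} {m : MeasurableSpace α} {μ : Measure α} [NormedAddCommGroup E]

theorem tendsto_Lp_of_dominated {r : ℝ≥0∞} [Fact (1 ≤ r)] (hr : r ≠ ⊤) {f : ℕ → Lp E r μ}
    {g : Lp E r μ} {b : α → ℝ} (hb : MemLp b r μ) (hbd : ∀ n, ∀ᵐ x ∂μ, ‖f n x - g x‖ ≤ b x)
    (hlim : ∀ᵐ x ∂μ, Tendsto (fun n => f n x) atTop (𝓝 (g x))) :
    Tendsto f atTop (𝓝 g) := by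
  have hr0 : r ≠ 0 := (zero_lt_one.trans_le (Fact.out : 1 ≤ r)).ne'
  have hrpos : 0 < r.toReal := ENNReal.toReal_pos hr0 hr
  rw [Lp.tendsto_Lp_iff_tendsto_eLpNorm']
  have key : Tendsto (fun n => ∫⁻ x, ‖(f n x - g x : E)‖ₑ ^ r.toReal ∂μ) atTop (𝓝 0) := by
    have := tendsto_lintegral_of_dominated_convergence' (μ := μ)
      (F := fun n x => ‖(f n x - g x : E)‖ₑ ^ r.toReal) (f := fun _ => 0)
      (fun x => ‖b x‖ₑ ^ r.toReal)
      (fun n => (((Lp.aestronglyMeasurable (f n)).sub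
        (Lp.aestronglyMeasurable g)).enorm).pow_const _) ?_ ?_ ?_
    · simpa using this
    · intro n
      filter_upwards [hbd n] with x hx
      refine ENNReal.rpow_le_rpow ?_ hrpos.le
      rw [enorm_le_iff_norm_le]
      exact hx.trans (le_abs_self _)
    · exact (lintegral_rpow_enorm_lt_top_of_eLpNorm_lt_top hr0 hr hb.2).ne
    · filter_upwards [hlim] with x hx
      have h1 : Tendsto (fun n => ‖(f n x - g x : E)‖ₑ) atTop (𝓝 0) := by
        have := (hx.sub_const (g x)).enorm
        simpa using this
      have := (ENNReal.continuous_rpow_const (y := r.toReal)).continuousAt.tendsto.comp h1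
      simpa [Function.comp_def, ENNReal.zero_rpow_of_pos hrpos] using this
  have h2 := (ENNReal.continuous_rpow_const (y := 1 / r.toReal)).continuousAt.tendsto.comp key
  rw [ENNReal.zero_rpow_of_pos (by positivity)] at h2
  refine h2.congr fun n => ?_
  rw [eLpNorm_eq_lintegral_rpow_enorm_toReal hr0 hr]
  simp

theorem exists_subseq_ae {r : ℝ≥0∞} [Fact (1 ≤ r)] {f : ℕ → Lp E r μ} {g : Lp E r μ}
    (h : Tendsto f atTop (𝓝 g)) : ∃ ns : ℕ → ℕ, StrictMono ns ∧
      ∀ᵐ x ∂μ, Tendsto (fun n => f (ns n) x) atTop (𝓝 (g x)) :=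
  (tendstoInMeasure_of_tendsto_Lp h).exists_seq_tendsto_ae

end Lp

section Sobolev

theorem three_le_cast (N : ℕ) [hN : Fact (3 ≤ N)] : (3 : ℝ) ≤ N := by exact_mod_cast hN.out

variable {N : ℕ}

theorem sobolevExp_ne_top : sobolevExp N ≠ ⊤ := ENNReal.ofReal_ne_top

theorem continuous_gradient {φ : Eucl N → ℝ} (hφ : ContDiff ℝ ((⊤ : ℕ∞) : WithTop ℕ∞) φ) :
    Continuous (gradient φ) :=
  (InnerProductSpace.toDual ℝ (Eucl N)).symm.continuous.comp (hφ.continuous_fderiv (by simp))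

theorem hasCompactSupport_gradient {φ : Eucl N → ℝ} (hφ : HasCompactSupport φ) :
    HasCompactSupport (gradient φ) :=
  (hφ.fderiv ℝ).comp_left (g := (InnerProductSpace.toDual ℝ (Eucl N)).symm) (map_zero _)

theorem support_gradient_subset (φ : Eucl N → ℝ) :
    Function.support (gradient φ) ⊆ tsupport φ := by
  refine Subset.trans ?_ (support_fderiv_subset ℝ (f := φ))
  intro x hx h
  exact hx (by simp [gradient, h])

theorem norm_gradient (φ : Eucl N → ℝ) (x : Eucl N) : ‖gradient φ x‖ = ‖fderiv ℝ φ x‖ := by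
  simp [gradient]

variable {Ω : Set (Eucl N)}

theorem memLp_test {φ : Eucl N → ℝ} (hφ : ContDiff ℝ ((⊤ : ℕ∞) : WithTop ℕ∞) φ)
    (hc : HasCompactSupport φ) (r : ℝ≥0∞) : MemLp φ r (vol Ω) :=
  hφ.continuous.memLp_of_hasCompactSupport hc

theorem memLp_gradient_test {φ : Eucl N → ℝ} (hφ : ContDiff ℝ ((⊤ : ℕ∞) : WithTop ℕ∞) φ)
    (hc : HasCompactSupport φ) (r : ℝ≥0∞) : MemLp (gradient φ) r (vol Ω) :=
  (continuous_gradient hφ).memLp_of_hasCompactSupport (hasCompactSupport_gradient hc)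

variable [hN : Fact (3 ≤ N)]

/-- The element `(φ, ∇φ)` of `W^{1,2}_0(Ω)` given by a test function. -/
def ofTest (Ω : Set (Eucl N)) (φ : Eucl N → ℝ) (hφ : ContDiff ℝ ((⊤ : ℕ∞) : WithTop ℕ∞) φ)
    (hc : HasCompactSupport φ) (hs : tsupport φ ⊆ Ω) : W012 Ω :=
  ⟨((memLp_test hφ hc _).toLp φ, (memLp_gradient_test hφ hc _).toLp (gradient φ)),
    Submodule.le_topologicalClosure _
      ⟨φ, hφ, hc, hs, MemLp.coeFn_toLp (memLp_test hφ hc _),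
        MemLp.coeFn_toLp (memLp_gradient_test hφ hc _)⟩⟩

theorem fnOf_ofTest {φ : Eucl N → ℝ} (hφ : ContDiff ℝ ((⊤ : ℕ∞) : WithTop ℕ∞) φ)
    (hc : HasCompactSupport φ) (hs : tsupport φ ⊆ Ω) : fnOf (ofTest Ω φ hφ hc hs) =ᵐ[vol Ω] φ :=
  MemLp.coeFn_toLp (memLp_test hφ hc _)

theorem gradOf_ofTest {φ : Eucl N → ℝ} (hφ : ContDiff ℝ ((⊤ : ℕ∞) : WithTop ℕ∞) φ)
    (hc : HasCompactSupport φ) (hs : tsupport φ ⊆ Ω) :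
    gradOf (ofTest Ω φ hφ hc hs) =ᵐ[vol Ω] gradient φ :=
  MemLp.coeFn_toLp (memLp_gradient_test hφ hc _)

theorem norm_fst_eq_of_test {w : PairSpace Ω} {φ : Eucl N → ℝ} (hs : tsupport φ ⊆ Ω)
    (h : w.1 =ᵐ[vol Ω] φ) : ‖w.1‖ = (eLpNorm φ (sobolevExp N) volume).toReal := by
  rw [Lp.norm_def, eLpNorm_congr_ae h,
    eLpNorm_restrict_eq_of_support_subset ((subset_tsupport φ).trans hs)]

theorem norm_snd_eq_of_test {w : PairSpace Ω} {φ : Eucl N → ℝ} (hs : tsupport φ ⊆ Ω)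
    (h : w.2 =ᵐ[vol Ω] gradient φ) : ‖w.2‖ = (eLpNorm (gradient φ) 2 volume).toReal := by
  rw [Lp.norm_def, eLpNorm_congr_ae h,
    eLpNorm_restrict_eq_of_support_subset ((support_gradient_subset φ).trans hs)]

/-- A closed property which holds for test functions holds on `W^{1,2}_0(Ω)`. -/
theorem W012_induction {P : PairSpace Ω → Prop} (hP : IsClosed {w | P w})
    (h : ∀ w ∈ testPairs Ω, P w) (u : W012 Ω) : P u.1 :=
  closure_minimal (s := (testPairs Ω : Set (PairSpace Ω))) h hP u.2

/-- Sobolev's inequality on `W^{1,2}_0(Ω)`. -/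
theorem exists_sobolev_bound (N : ℕ) [hN : Fact (3 ≤ N)] : ∃ S : ℝ, 0 < S ∧
    ∀ (Ω : Set (Eucl N)) (u : W012 Ω), ‖fnOf u‖ ≤ S * ‖gradOf u‖ := by
  have h3 := three_le_cast N
  set C := eLpNormLESNormFDerivOfEqInnerConst (volume : Measure (Eucl N)) ((2 : NNReal) : ℝ) with hC
  refine ⟨C + 1, by positivity, fun Ω u => ?_⟩
  refine W012_induction (P := fun w => ‖w.1‖ ≤ (C + 1) * ‖w.2‖)
    (isClosed_le (by fun_prop) (by fun_prop)) ?_ u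
  rintro w ⟨φ, hφ, hc, hs, h1, h2⟩
  rw [norm_fst_eq_of_test hs h1, norm_snd_eq_of_test hs h2]
  have hg : eLpNorm (gradient φ) 2 volume = eLpNorm (fderiv ℝ φ) 2 volume :=
    eLpNorm_congr_norm_ae (Eventually.of_forall (norm_gradient φ))
  have hfin : eLpNorm (gradient φ) 2 volume ≠ ⊤ :=
    ((continuous_gradient hφ).memLp_of_hasCompactSupport (hasCompactSupport_gradient hc)).2.ne
  have key := eLpNorm_le_eLpNorm_fderiv_of_eq_inner (volume : Measure (Eucl N)) (u := φ)
    (hφ.of_le (by simp)) hc (p := 2) (p' := (2 * (N : ℝ) / ((N : ℝ) - 2)).toNNReal) (by norm_num)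
    (by simp; linarith [hN.out]) (by
      rw [Real.coe_toNNReal _ (div_nonneg (by positivity) (by linarith))]
      have : (N : ℝ) - 2 ≠ 0 := by linarith
      have : (N : ℝ) ≠ 0 := by linarith
      simp
      field_simp)
  change eLpNorm φ (sobolevExp N) volume ≤ _ at key
  have h2' : (((2 : NNReal) : ℝ≥0∞)) = 2 := rfl
  rw [h2', ← hg, ← hC] at key
  calc (eLpNorm φ (sobolevExp N) volume).toReal
      ≤ ((C : ℝ≥0∞) * eLpNorm (gradient φ) 2 volume).toReal :=
        ENNReal.toReal_mono (ENNReal.mul_ne_top ENNReal.coe_ne_top hfin) key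
    _ = C * (eLpNorm (gradient φ) 2 volume).toReal := by simp
    _ ≤ _ := by gcongr; linarith

theorem sobolevConst_pos (N : ℕ) [hN : Fact (3 ≤ N)] : 0 < sobolevConst N := by
  obtain ⟨S, hS, h⟩ := exists_sobolev_bound N
  refine lt_of_lt_of_le (b := ENNReal.ofReal (S⁻¹ ^ 2)) (by simpa using by positivity) ?_
  refine le_iInf₂ fun v hv => ENNReal.ofReal_le_ofReal ?_
  have := h univ v
  rw [hv] at this
  gcongr
  rwa [inv_le_iff_one_le_mul₀' hS]

/-- The sharp Sobolev inequality, transferred to `Ω` by extension by zero. -/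
theorem sq_norm_le_of_le_sobolevConst {t : ℝ}
    (ht : ENNReal.ofReal t ≤ sobolevConst N) (u : W012 Ω) :
    t * ‖fnOf u‖ ^ 2 ≤ ‖gradOf u‖ ^ 2 := by
  refine W012_induction (P := fun w => t * ‖w.1‖ ^ 2 ≤ ‖w.2‖ ^ 2)
    (isClosed_le (by fun_prop) (by fun_prop)) ?_ u
  rintro w ⟨φ, hφ, hc, hs, h1, h2⟩
  set v := ofTest univ φ hφ hc (subset_univ _) with hv
  have e1 : ‖w.1‖ = ‖fnOf v‖ := by
    rw [norm_fst_eq_of_test hs h1]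
    exact (norm_fst_eq_of_test (w := v.1) (subset_univ _) (fnOf_ofTest hφ hc _)).symm
  have e2 : ‖w.2‖ = ‖gradOf v‖ := by
    rw [norm_snd_eq_of_test hs h2]
    exact (norm_snd_eq_of_test (w := v.1) (subset_univ _) (gradOf_ofTest hφ hc _)).symm
  rw [e1, e2]
  rcases eq_or_ne ‖fnOf v‖ 0 with h0 | h0
  · rw [h0]; simp
  have hn : ‖fnOf (‖fnOf v‖⁻¹ • v)‖ = 1 := by
    change ‖‖fnOf v‖⁻¹ • fnOf v‖ = 1
    rw [norm_smul, norm_inv, norm_norm, inv_mul_cancel₀ h0]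
  have hle : ENNReal.ofReal t ≤ ENNReal.ofReal (‖gradOf (‖fnOf v‖⁻¹ • v)‖ ^ 2) :=
    ht.trans (iInf₂_le (‖fnOf v‖⁻¹ • v) hn)
  rw [ENNReal.ofReal_le_ofReal_iff (by positivity)] at hle
  change t ≤ ‖‖fnOf v‖⁻¹ • gradOf v‖ ^ 2 at hle
  rw [norm_smul, norm_inv, norm_norm, mul_pow, inv_pow, ← div_eq_inv_mul,
    le_div_iff₀ (by positivity)] at hle
  exact hle

end Sobolev

end

section

/-- Smooth truncations at height `k` and at level `1 / k`. -/
theorem exists_smooth_truncation : ∃ (F : ℕ → ℝ → ℝ) (L : ℝ), 0 ≤ L ∧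
    (∀ k, ContDiff ℝ ((⊤ : ℕ∞) : WithTop ℕ∞) (F k)) ∧ (∀ k, F k 0 = 0) ∧
    (∀ k t, |deriv (F k) t| ≤ L) ∧
    (∀ t, t ≠ 0 → Tendsto (fun k => deriv (F k) t) atTop (𝓝 1)) ∧
    (∀ t, Tendsto (fun k => F k t) atTop (𝓝 t)) ∧
    (∀ k, ∃ δ, 0 < δ ∧ ∀ t, |t| ≤ δ → F k t = 0) ∧
    (∀ k, ∃ M, ∀ t, |F k t| ≤ M) := by
  let η : ContDiffBump (0 : ℝ) := ⟨1, 2, by norm_num, by norm_num⟩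
  let ζ : ℝ → ℝ := fun s => s * η s
  have hζ : ContDiff ℝ ((⊤ : ℕ∞) : WithTop ℕ∞) ζ := contDiff_id.mul η.contDiff
  have hζc : HasCompactSupport ζ := η.hasCompactSupport.mul_left
  have hζd : Differentiable ℝ ζ := hζ.differentiable (by simp)
  have hζ1 : ∀ s, |s| ≤ 1 → ζ s = s := fun s hs => by
    have : η s = 1 := η.one_of_mem_closedBall (by simpa using hs)
    simp [ζ, this]
  have hd : Continuous (deriv ζ) := hζ.continuous_deriv (by simp)
  obtain ⟨L, hL⟩ := hd.bounded_above_of_compact_support hζc.deriv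
  obtain ⟨M, hM⟩ := hζ.continuous.bounded_above_of_compact_support hζc
  have hd0 : deriv ζ 0 = 1 := by
    have : ζ =ᶠ[𝓝 0] id := by
      filter_upwards [Metric.closedBall_mem_nhds (0 : ℝ) one_pos] with s hs
      exact hζ1 s (by simpa using hs)
    rw [this.deriv_eq]; simp
  have hlarge : Tendsto (fun k : ℕ => (k : ℝ) + 1) atTop atTop :=
    tendsto_atTop_add_const_right _ _ tendsto_natCast_atTop_atTop
  have hdF : ∀ (k : ℕ) (t : ℝ),
      HasDerivAt (fun t => ((k : ℝ) + 1) * ζ (t / (k + 1)) - ζ ((k + 1) * t) / (k + 1))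
        (deriv ζ (t / (k + 1)) - deriv ζ ((k + 1) * t)) t := by
    intro k t
    have hk : (k : ℝ) + 1 ≠ 0 := by positivity
    have h1 : HasDerivAt (fun t => ζ (t / (k + 1))) (deriv ζ (t / (k + 1)) * (1 / (k + 1))) t :=
      (hζd _).hasDerivAt.comp t ((hasDerivAt_id t).div_const _)
    have h2 : HasDerivAt (fun t => ζ ((k + 1) * t)) (deriv ζ ((k + 1) * t) * ((k + 1) * 1)) t :=
      (hζd _).hasDerivAt.comp t ((hasDerivAt_id t).const_mul _)
    refine ((h1.const_mul ((k : ℝ) + 1)).sub (h2.div_const ((k : ℝ) + 1))).congr_deriv ?_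
    field_simp
  refine ⟨fun k t => ((k : ℝ) + 1) * ζ (t / (k + 1)) - ζ ((k + 1) * t) / (k + 1), 2 * L,
    by linarith [(norm_nonneg _).trans (hL 0)], ?_, ?_, ?_, ?_, ?_, ?_, ?_⟩
  · intro k
    exact ((contDiff_const.mul (hζ.comp (contDiff_id.div_const _)))).sub
      ((hζ.comp (contDiff_const.mul contDiff_id)).div_const _)
  · intro k; simp [ζ]
  · intro k t
    rw [(hdF k t).deriv]
    refine (abs_sub _ _).trans ?_
    have h1 := hL (t / (k + 1)); have h2 := hL ((k + 1) * t)
    rw [Real.norm_eq_abs] at h1 h2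
    linarith
  · intro t ht
    have h1 : Tendsto (fun k : ℕ => deriv ζ (t / (k + 1))) atTop (𝓝 1) := by
      have h := (hd.tendsto 0).comp (hlarge.const_div_atTop t)
      rwa [hd0] at h
    have h2 : ∀ᶠ k : ℕ in atTop, deriv ζ ((k + 1) * t) = 0 := by
      filter_upwards [hlarge.eventually_gt_atTop (2 / |t|)] with k hk
      have : ((k : ℝ) + 1) * t ∉ tsupport (deriv ζ) := by
        intro h
        have h' := (tsupport_deriv_subset (𝕜 := ℝ) (f := ζ)).trans (closure_mono (by
          intro x hx hη; exact hx (by simp [ζ, hη]) : Function.support ζ ⊆ Function.support η)) h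
        change _ ∈ tsupport η at h'
        rw [η.tsupport_eq, mem_closedBall_zero_iff, Real.norm_eq_abs, abs_mul,
          abs_of_pos (by positivity)] at h'
        rw [div_lt_iff₀ (by positivity)] at hk
        exact absurd h' (not_le.2 hk)
      exact image_eq_zero_of_notMem_tsupport this
    have := h1.congr' (h2.mono fun k hk => show _ = deriv ζ (t / (k + 1)) - deriv ζ ((k + 1) * t)
      by rw [hk, sub_zero])
    exact this.congr fun k => (hdF k t).deriv.symm
  · intro t
    have h1 : ∀ᶠ k : ℕ in atTop, ((k : ℝ) + 1) * ζ (t / (k + 1)) = t := by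
      filter_upwards [hlarge.eventually_ge_atTop |t|] with k hk
      have hk' : (0 : ℝ) < k + 1 := by positivity
      rw [hζ1, mul_div_cancel₀ _ hk'.ne']
      rwa [abs_div, abs_of_pos hk', div_le_one hk']
    have h2 : Tendsto (fun k : ℕ => ζ ((k + 1) * t) / (k + 1)) atTop (𝓝 0) := by
      refine squeeze_zero_norm (a := fun k : ℕ => M / (k + 1)) (fun k => ?_)
        (hlarge.const_div_atTop M)
      rw [norm_div, Real.norm_of_nonneg (by positivity : (0 : ℝ) ≤ k + 1)]
      gcongr
      exact hM _
    have := (tendsto_const_nhds (x := t)).sub h2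
    rw [sub_zero] at this
    refine this.congr' (h1.mono fun k hk => ?_)
    simp only [hk]
  · intro k
    have hk : (0 : ℝ) < k + 1 := by positivity
    refine ⟨1 / (k + 1), by positivity, fun t ht => ?_⟩
    have h1 : |(k + 1) * t| ≤ 1 := by
      rw [abs_mul, abs_of_pos hk, ← le_div_iff₀' hk]; exact ht
    have h2 : |t / (k + 1)| ≤ 1 := by
      rw [abs_div, abs_of_pos hk, div_le_one hk]
      refine ht.trans ?_
      rw [div_le_iff₀ hk]
      nlinarith [(Nat.cast_nonneg k : (0 : ℝ) ≤ k)]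
    simp only [hζ1 _ h1, hζ1 _ h2]
    field_simp
    ring
  · intro k
    have hk : (0 : ℝ) < k + 1 := by positivity
    refine ⟨(k + 1) * M + M / (k + 1), fun t => (abs_sub _ _).trans ?_⟩
    rw [abs_mul, abs_div, abs_of_pos hk]
    gcongr
    · exact hM _
    · exact hM _

variable {N : ℕ} {Ω : Set (Eucl N)}

theorem inner_gradient (φ : Eucl N → ℝ) (x v : Eucl N) :
    inner ℝ (gradient φ x) v = fderiv ℝ φ x v := by
  simp [gradient]

variable [hN : Fact (3 ≤ N)]

theorem integral_fnOf_mul_fderiv (u : W012 Ω) {ψ : Eucl N → ℝ}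
    (hψ : ContDiff ℝ ((⊤ : ℕ∞) : WithTop ℕ∞) ψ) (hcψ : HasCompactSupport ψ)
    (hsψ : tsupport ψ ⊆ Ω) (v : Eucl N) :
    ∫ x, fnOf u x * fderiv ℝ ψ x v ∂(vol Ω) = - ∫ x, inner ℝ (gradOf u x) (ψ x • v) ∂(vol Ω) := by
  have hDc : Continuous fun x => fderiv ℝ ψ x v :=
    (hψ.continuous_fderiv (by simp)).clm_apply continuous_const
  have hDs : HasCompactSupport fun x => fderiv ℝ ψ x v :=
    (hcψ.fderiv ℝ).comp_left (g := fun L : Eucl N →L[ℝ] ℝ => L v) (by simp)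
  have := ENNReal.HolderConjugate.conjExponent (p := sobolevExp N) Fact.out
  set r := ENNReal.conjExponent (sobolevExp N) with hr
  have : Fact (1 ≤ r) := ⟨ENNReal.HolderConjugate.one_le r (sobolevExp N)⟩
  have hD : MemLp (fun x => fderiv ℝ ψ x v) r (vol Ω) := hDc.memLp_of_hasCompactSupport hDs
  have hψv : MemLp (fun x => ψ x • v) 2 (vol Ω) :=
    (hψ.continuous.smul continuous_const).memLp_of_hasCompactSupport hcψ.smul_right
  let A : Lp ℝ (sobolevExp N) (vol Ω) →L[ℝ] ℝ :=
    ((ContinuousLinearMap.mul ℝ ℝ).lpPairing (vol Ω) (sobolevExp N) r).flip hD.toLp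
  let B : Lp (Eucl N) 2 (vol Ω) →L[ℝ] ℝ :=
    ((innerSL ℝ (E := Eucl N)).lpPairing (vol Ω) 2 2).flip hψv.toLp
  have hA : ∀ w, A w = ∫ x, w x * fderiv ℝ ψ x v ∂(vol Ω) := fun w => by
    simp only [A, ContinuousLinearMap.flip_apply, ContinuousLinearMap.lpPairing_eq_integral]
    refine integral_congr_ae ?_
    filter_upwards [hD.coeFn_toLp] with x hx
    simp [hx]
  have hB : ∀ w, B w = ∫ x, inner ℝ (w x) (ψ x • v) ∂(vol Ω) := fun w => by
    simp only [B, ContinuousLinearMap.flip_apply, ContinuousLinearMap.lpPairing_eq_integral]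
    refine integral_congr_ae ?_
    filter_upwards [hψv.coeFn_toLp] with x hx
    rw [hx]
    rfl
  rw [← hA, ← hB]
  refine W012_induction (P := fun w => A w.1 = - B w.2)
    (isClosed_eq (by fun_prop) (by fun_prop)) ?_ u
  rintro w ⟨φ, hφ, hc, hs, h1, h2⟩
  rw [hA, hB]
  have e1 : ∫ x, w.1 x * fderiv ℝ ψ x v ∂(vol Ω) = ∫ x, φ x * fderiv ℝ ψ x v := by
    rw [integral_congr_ae (g := fun x => φ x * fderiv ℝ ψ x v)
      (by filter_upwards [h1] with x hx; rw [hx])]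
    refine setIntegral_eq_integral_of_forall_compl_eq_zero fun x hx => ?_
    rw [image_eq_zero_of_notMem_tsupport (fun h => hx (hs h)), zero_mul]
  have e2 : ∫ x, inner ℝ (w.2 x) (ψ x • v) ∂(vol Ω) = ∫ x, fderiv ℝ φ x v * ψ x := by
    rw [integral_congr_ae (g := fun x => fderiv ℝ φ x v * ψ x) (by
      filter_upwards [h2] with x hx
      rw [hx, inner_smul_right, inner_gradient, mul_comm])]
    refine setIntegral_eq_integral_of_forall_compl_eq_zero fun x hx => ?_
    rw [image_eq_zero_of_notMem_tsupport (fun h => hx (hsψ h)), mul_zero]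
  rw [e1, e2]
  have hDφ : Continuous fun x => fderiv ℝ φ x v :=
    (hφ.continuous_fderiv (by simp)).clm_apply continuous_const
  refine integral_mul_fderiv_eq_neg_fderiv_mul_of_integrable ?_ ?_ ?_
    (fun x _ => hφ.differentiable (by simp) x) (fun x _ => hψ.differentiable (by simp) x)
  · exact (hDφ.mul hψ.continuous).integrable_of_hasCompactSupport hcψ.mul_left
  · exact (hφ.continuous.mul hDc).integrable_of_hasCompactSupport hc.mul_right
  · exact (hφ.continuous.mul hψ.continuous).integrable_of_hasCompactSupport hc.mul_right

/-- The gradient of an element of `W^{1,2}_0(Ω)` is determined by the function. -/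
theorem gradOf_eq_zero (hΩ : IsOpen Ω) {u : W012 Ω} (hu : fnOf u = 0) : gradOf u = 0 := by
  have hloc : LocallyIntegrable (gradOf u) (vol Ω) :=
    (Lp.memLp (gradOf u)).locallyIntegrable (by norm_num)
  have key := hΩ.ae_eq_zero_of_integral_contDiff_smul_eq_zero (hloc.locallyIntegrableOn Ω) ?_
  · rw [Lp.eq_zero_iff_ae_eq_zero]
    filter_upwards [key, ae_restrict_mem hΩ.measurableSet] with x h1 h2 using h1 h2
  · intro ψ hψ hc hs
    refine ext_inner_right ℝ fun v => ?_
    have hint : Integrable (fun x => ψ x • gradOf u x) (vol Ω) :=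
      hloc.integrable_smul_left_of_hasCompactSupport hψ.continuous hc
    have h := integral_fnOf_mul_fderiv u hψ hc hs v
    rw [hu] at h
    have h0 : ∫ x, (0 : Lp ℝ (sobolevExp N) (vol Ω)) x * fderiv ℝ ψ x v ∂(vol Ω) = 0 := by
      refine integral_eq_zero_of_ae ?_
      filter_upwards [Lp.coeFn_zero ℝ (sobolevExp N) (vol Ω)] with x hx
      rw [hx, Pi.zero_apply, zero_mul]
    rw [h0] at h
    rw [inner_zero_left, real_inner_comm, ← integral_inner hint]
    have : ∀ x, inner ℝ v (ψ x • gradOf u x) = inner ℝ (gradOf u x) (ψ x • v) := fun x => by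
      rw [inner_smul_right, inner_smul_right, real_inner_comm]
    simp_rw [this]
    linarith

theorem fnOf_injective (hΩ : IsOpen Ω) {u v : W012 Ω} (h : fnOf u = fnOf v) : u = v := by
  have h1 : fnOf (u - v) = 0 := by
    change fnOf u - fnOf v = 0
    rw [h, sub_self]
  have h2 : gradOf u - gradOf v = 0 := gradOf_eq_zero hΩ h1
  exact Subtype.ext (Prod.ext h (sub_eq_zero.1 h2))

end

section

section Lp

variable {α E : Type*} {m : MeasurableSpace α} {μ : Measure α} [NormedAddCommGroup E]
  [NormedSpace ℝ E]

theorem memLp_smul_of_bounded {r : ℝ≥0∞} {a : α → ℝ} {L : ℝ} (ha : AEStronglyMeasurable a μ)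
    (hL : ∀ x, |a x| ≤ L) (h : Lp E r μ) : MemLp (fun x => a x • h x) r μ :=
  (Lp.memLp h).of_le_mul (c := L) (ha.smul (Lp.aestronglyMeasurable h)) (Eventually.of_forall
    fun x => by rw [norm_smul]; exact mul_le_mul_of_nonneg_right (hL x) (norm_nonneg _))

theorem tendsto_Lp_smul {r : ℝ≥0∞} [Fact (1 ≤ r)] (hr : r ≠ ⊤) {a : ℕ → α → ℝ} {b : α → ℝ}
    {L : ℝ} (hL : ∀ n x, |a n x| ≤ L) (hb : ∀ x, |b x| ≤ L) {f : ℕ → Lp E r μ} {g h : Lp E r μ}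
    (hf : ∀ n, f n =ᵐ[μ] fun x => a n x • h x) (hg : g =ᵐ[μ] fun x => b x • h x)
    (hlim : ∀ᵐ x ∂μ, h x ≠ 0 → Tendsto (fun n => a n x) atTop (𝓝 (b x))) :
    Tendsto f atTop (𝓝 g) := by
  refine tendsto_Lp_of_dominated hr (b := fun x => 2 * L * ‖h x‖) ((Lp.memLp h).norm.const_mul _)
    (fun n => ?_) ?_
  · filter_upwards [hf n, hg] with x h1 h2
    rw [h1, h2, ← sub_smul, norm_smul, Real.norm_eq_abs]
    gcongr
    exact (abs_sub _ _).trans (by linarith [hL n x, hb x])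
  · filter_upwards [ae_all_iff.2 hf, hg, hlim] with x h1 h2 h3
    simp_rw [h1, h2]
    by_cases h0 : h x = 0
    · simp [h0]
    · exact (h3 h0).smul_const _

end Lp

variable {N : ℕ} {Ω : Set (Eucl N)}

theorem gradient_comp {F : ℝ → ℝ} (hF : Differentiable ℝ F) {φ : Eucl N → ℝ}
    (hφ : Differentiable ℝ φ) (x : Eucl N) :
    gradient (F ∘ φ) x = deriv F (φ x) • gradient φ x := by
  have : fderiv ℝ (F ∘ φ) x = deriv F (φ x) • fderiv ℝ φ x :=
    ((hF (φ x)).hasDerivAt.comp_hasFDerivAt x (hφ x).hasFDerivAt).fderiv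
  simp [gradient, this]

variable [hN : Fact (3 ≤ N)]

/-- The chain rule in `W^{1,2}_0(Ω)`. -/
theorem exists_chainRule {F : ℝ → ℝ} {L : ℝ} (hF : ContDiff ℝ ((⊤ : ℕ∞) : WithTop ℕ∞) F)
    (h0 : F 0 = 0) (hL : ∀ t, |deriv F t| ≤ L) (u : W012 Ω) :
    ∃ w : W012 Ω, (fnOf w =ᵐ[vol Ω] fun x => F (fnOf u x)) ∧
      gradOf w =ᵐ[vol Ω] fun x => deriv F (fnOf u x) • gradOf u x := by
  have hFd : Differentiable ℝ F := hF.differentiable (by simp)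
  have hL0 : 0 ≤ L := (abs_nonneg _).trans (hL 0)
  have hlip : LipschitzWith L.toNNReal F := lipschitzWith_of_nnnorm_deriv_le hFd fun t => by
    rw [← NNReal.coe_le_coe, Real.coe_toNNReal _ hL0]; exact hL t
  have hdc : Continuous (deriv F) := hF.continuous_deriv (by simp)
  have hmeas : ∀ z : Lp ℝ (sobolevExp N) (vol Ω),
      AEStronglyMeasurable (fun x => deriv F (z x)) (vol Ω) := fun z =>
    hdc.comp_aestronglyMeasurable (Lp.aestronglyMeasurable z)
  obtain ⟨w, hw, hwu⟩ := mem_closure_iff_seq_limit.1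
    (show u.1 ∈ closure (testPairs Ω : Set (PairSpace Ω)) from u.2)
  obtain ⟨ns, hns, hae⟩ := exists_subseq_ae ((continuous_fst.tendsto _).comp hwu)
  have hwu' := hwu.comp hns.tendsto_atTop
  let D : Lp ℝ (sobolevExp N) (vol Ω) → Lp (Eucl N) 2 (vol Ω) → Lp (Eucl N) 2 (vol Ω) :=
    fun z g => (memLp_smul_of_bounded (hmeas z) (fun x => hL (z x)) g).toLp
  have hD : ∀ z g, D z g =ᵐ[vol Ω] fun x => deriv F (z x) • g x := fun z g =>
    MemLp.coeFn_toLp (memLp_smul_of_bounded (hmeas z) (fun x => hL (z x)) g)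
  have htest : ∀ n, (hlip.compLp h0 (w n).1, D (w n).1 (w n).2) ∈ testPairs Ω := by
    intro n
    obtain ⟨φ, hφ, hc, hs, h1, h2⟩ := hw n
    have hsub : tsupport (F ∘ φ) ⊆ tsupport φ := closure_mono fun x hx hφx => hx (by
      simp [hφx, h0])
    refine ⟨F ∘ φ, hF.comp hφ, hc.comp_left h0, hsub.trans hs, ?_, ?_⟩
    · filter_upwards [hlip.coeFn_compLp h0 (w n).1, h1] with x hx hx'
      simp only [hx, Function.comp, hx']
    · filter_upwards [hD (w n).1 (w n).2, h1, h2] with x hx h1 h2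
      simp only [hx, h1, h2]
      rw [gradient_comp hFd (hφ.differentiable (by simp))]
  have hlim2 : Tendsto (fun n => D (w (ns n)).1 (w (ns n)).2) atTop (𝓝 (D u.1.1 u.1.2)) := by
    have t1 : Tendsto (fun n => D (w (ns n)).1 u.1.2) atTop (𝓝 (D u.1.1 u.1.2)) := by
      refine tendsto_Lp_smul (by norm_num) (fun n x => hL ((w (ns n)).1 x)) (fun x => hL (u.1.1 x))
        (fun n => hD _ _) (hD _ _) ?_
      filter_upwards [hae] with x hx _ using (hdc.tendsto _).comp hx
    have t2 : Tendsto (fun n => D (w (ns n)).1 (w (ns n)).2 - D (w (ns n)).1 u.1.2) atTop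
        (𝓝 0) := by
      have h3 : Tendsto (fun n => L * ‖(w (ns n)).2 - u.1.2‖) atTop (𝓝 0) := by
        have := (((continuous_snd.tendsto _).comp hwu').sub_const u.1.2).norm.const_mul L
        simpa using this
      refine squeeze_zero_norm (fun n => ?_) h3
      refine Lp.norm_le_mul_norm_of_ae_le_mul ?_
      filter_upwards [Lp.coeFn_sub (D (w (ns n)).1 (w (ns n)).2) (D (w (ns n)).1 u.1.2),
        hD (w (ns n)).1 (w (ns n)).2, hD (w (ns n)).1 u.1.2,
        Lp.coeFn_sub (w (ns n)).2 u.1.2] with x a1 a2 a3 a4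
      rw [a1, a4, Pi.sub_apply, Pi.sub_apply, a2, a3, ← smul_sub, norm_smul]
      exact mul_le_mul_of_nonneg_right (hL _) (norm_nonneg _)
    simpa using t2.add t1
  have hlim1 : Tendsto (fun n => hlip.compLp h0 (w (ns n)).1) atTop
      (𝓝 (hlip.compLp h0 u.1.1)) :=
    ((hlip.continuous_compLp h0).tendsto _).comp ((continuous_fst.tendsto _).comp hwu')
  refine ⟨⟨(hlip.compLp h0 u.1.1, D u.1.1 u.1.2), mem_closure_of_tendsto
    (hlim1.prodMk_nhds hlim2) (Eventually.of_forall fun n => htest _)⟩, ?_, hD _ _⟩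
  exact hlip.coeFn_compLp h0 u.1.1

/-- Every element of `W^{1,2}_0(Ω)` is the limit of elements belonging to all the Lebesgue
spaces, and dominated by a multiple of it. -/
theorem exists_truncation (hΩ : IsOpen Ω) (u : W012 Ω) : ∃ (w : ℕ → W012 Ω) (L : ℝ),
    (∀ n, ∀ q : ℝ, 0 < q → eLpNorm (fnOf (w n)) (ENNReal.ofReal q) (vol Ω) < ⊤) ∧
    Tendsto (fun n => gradOf (w n)) atTop (𝓝 (gradOf u)) ∧
    (∀ n, ∀ᵐ x ∂(vol Ω), |fnOf (w n) x| ≤ L * |fnOf u x|) ∧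
    ∀ᵐ x ∂(vol Ω), Tendsto (fun n => fnOf (w n) x) atTop (𝓝 (fnOf u x)) := by
  obtain ⟨F, L, hL0, hF, hF0, hFL, hF1, hFid, hFδ, hFM⟩ := exists_smooth_truncation
  choose w hw hgw using fun n => exists_chainRule (hF n) (hF0 n) (hFL n) u
  have hbd : ∀ n t, |F n t| ≤ L * |t| := fun n t => by
    have hlip : LipschitzWith L.toNNReal (F n) :=
      lipschitzWith_of_nnnorm_deriv_le ((hF n).differentiable (by simp)) fun t => by
        rw [← NNReal.coe_le_coe, Real.coe_toNNReal _ hL0]; exact hFL n t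
    have := hlip.dist_le_mul t 0
    rwa [hF0, Real.coe_toNNReal _ hL0, dist_zero_right, dist_zero_right] at this
  have hae : ∀ᵐ x ∂(vol Ω), Tendsto (fun n => fnOf (w n) x) atTop (𝓝 (fnOf u x)) := by
    filter_upwards [ae_all_iff.2 hw] with x hx
    simp_rw [hx]
    exact hFid _
  have hle : ∀ n, ∀ᵐ x ∂(vol Ω), |fnOf (w n) x| ≤ L * |fnOf u x| := fun n => by
    filter_upwards [hw n] with x hx
    rw [hx]
    exact hbd n _
  have hlim1 : Tendsto (fun n => fnOf (w n)) atTop (𝓝 (fnOf u)) := by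
    refine tendsto_Lp_of_dominated sobolevExp_ne_top (b := fun x => (L + 1) * ‖fnOf u x‖)
      ((Lp.memLp (fnOf u)).norm.const_mul _) (fun n => ?_) hae
    filter_upwards [hle n] with x hx
    refine (norm_sub_le _ _).trans ?_
    rw [Real.norm_eq_abs, Real.norm_eq_abs]
    linarith
  let b : Eucl N → ℝ := {x | fnOf u x ≠ 0}.indicator fun _ => 1
  have hms : MeasurableSet {x | fnOf u x ≠ 0} :=
    (Lp.stronglyMeasurable (fnOf u)).measurable (measurableSet_singleton 0).compl
  have hb1 : ∀ x, |b x| ≤ L + 1 := fun x => by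
    by_cases hx : x ∈ {x | fnOf u x ≠ 0} <;> simp only [b, hx, indicator_of_mem,
      indicator_of_notMem, not_false_eq_true, abs_one, abs_zero] <;> linarith
  have hbm : AEStronglyMeasurable b (vol Ω) :=
    (stronglyMeasurable_const.indicator hms).aestronglyMeasurable
  set g : Lp (Eucl N) 2 (vol Ω) := (memLp_smul_of_bounded hbm hb1 (gradOf u)).toLp with hgdef
  have hg : g =ᵐ[vol Ω] fun x => b x • gradOf u x :=
    MemLp.coeFn_toLp (memLp_smul_of_bounded hbm hb1 (gradOf u))
  have hFz : ∀ n, deriv (F n) 0 = 0 := fun n => by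
    obtain ⟨δ, hδ, h⟩ := hFδ n
    have : F n =ᶠ[𝓝 0] fun _ => 0 := by
      filter_upwards [Metric.closedBall_mem_nhds (0 : ℝ) hδ] with s hs
      exact h s (by simpa using hs)
    rw [this.deriv_eq]; simp
  have hlim2 : Tendsto (fun n => gradOf (w n)) atTop (𝓝 g) := by
    refine tendsto_Lp_smul (by norm_num) (L := L + 1)
      (fun n x => (hFL n (fnOf u x)).trans (by linarith)) hb1 hgw hg ?_
    refine Eventually.of_forall fun x _ => ?_
    by_cases hx : fnOf u x = 0
    · simp [b, hx, hFz]
    · have : b x = 1 := indicator_of_mem (s := {x | fnOf u x ≠ 0}) hx _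
      rw [this]
      exact hF1 _ hx
  have hmem : (fnOf u, g) ∈ W012 Ω :=
    (isClosed_closure (s := (testPairs Ω : Set (PairSpace Ω)))).mem_of_tendsto
      (hlim1.prodMk_nhds hlim2) (Eventually.of_forall fun n => (w n).2)
  have hgu : g = gradOf u := by
    have h := fnOf_injective hΩ (u := ⟨(fnOf u, g), hmem⟩) (v := u) rfl
    exact congrArg gradOf h
  refine ⟨w, L, fun n q hq => ?_, hgu ▸ hlim2, hle, hae⟩
  obtain ⟨δ, hδ, hδ0⟩ := hFδ n
  obtain ⟨M, hM⟩ := hFM n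
  have hs0 : sobolevExp N ≠ 0 := (zero_lt_one.trans_le (Fact.out : 1 ≤ sobolevExp N)).ne'
  set s := (sobolevExp N).toReal with hs
  have hsp : 0 < s := ENNReal.toReal_pos hs0 sobolevExp_ne_top
  have hM0 : 0 ≤ M := (abs_nonneg _).trans (hM 0)
  have hq0 : ENNReal.ofReal q ≠ 0 := by simpa using hq
  refine (eLpNorm_lt_top_iff_lintegral_rpow_enorm_lt_top hq0 ENNReal.ofReal_ne_top).2 ?_
  rw [ENNReal.toReal_ofReal hq.le]
  have hfin := lintegral_rpow_enorm_lt_top_of_eLpNorm_lt_top hs0 sobolevExp_ne_top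
    (Lp.memLp (fnOf u)).2
  rw [← hs] at hfin
  have hpt : ∀ t : ℝ, ‖F n t‖ₑ ^ q ≤ ENNReal.ofReal (M ^ q / δ ^ s) * ‖t‖ₑ ^ s := by
    intro t
    rw [← ofReal_norm, ← ofReal_norm,
      ENNReal.ofReal_rpow_of_nonneg (norm_nonneg _) hq.le,
      ENNReal.ofReal_rpow_of_nonneg (norm_nonneg _) hsp.le, ← ENNReal.ofReal_mul (by positivity)]
    refine ENNReal.ofReal_le_ofReal ?_
    rcases le_or_gt |t| δ with h | h
    · rw [hδ0 t h, norm_zero, Real.zero_rpow hq.ne']; positivity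
    · rw [div_mul_eq_mul_div, le_div_iff₀ (by positivity)]
      have h1 : ‖F n t‖ ^ q ≤ M ^ q := Real.rpow_le_rpow (norm_nonneg _) (hM t) hq.le
      have h2 : δ ^ s ≤ ‖t‖ ^ s := Real.rpow_le_rpow hδ.le h.le hsp.le
      gcongr
  calc ∫⁻ x, ‖fnOf (w n) x‖ₑ ^ q ∂(vol Ω)
      ≤ ∫⁻ x, ENNReal.ofReal (M ^ q / δ ^ s) * ‖fnOf u x‖ₑ ^ s ∂(vol Ω) := by
        refine lintegral_mono_ae ?_
        filter_upwards [hw n] with x hx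
        rw [hx]
        exact hpt _
    _ < ⊤ := by
        rw [lintegral_const_mul' _ _ ENNReal.ofReal_ne_top]
        exact ENNReal.mul_lt_top ENNReal.ofReal_lt_top hfin

end

section

section Inequalities

variable {α : Type*} {m : MeasurableSpace α} {μ : Measure α}

theorem lintegral_mul_enorm_sq_le {r r' : ℝ} (hr : r.HolderConjugate r') {W : α → ℝ≥0∞} {u : α → ℝ}
    (hW : AEMeasurable W μ) (hu : AEStronglyMeasurable u μ) :
    ∫⁻ x, W x * ‖u x‖ₑ ^ 2 ∂μ ≤
      eLpNorm W (ENNReal.ofReal r) μ * eLpNorm u (ENNReal.ofReal (2 * r')) μ ^ 2 := by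
  have hr0 := hr.pos
  have hr0' := hr.symm.pos
  refine (ENNReal.lintegral_mul_le_Lp_mul_Lq μ hr hW (hu.enorm.pow_const 2)).trans_eq ?_
  rw [eLpNorm_eq_lintegral_rpow_enorm_toReal (by simpa using hr0) ENNReal.ofReal_ne_top,
    eLpNorm_eq_lintegral_rpow_enorm_toReal (by simpa using hr0') ENNReal.ofReal_ne_top,
    ENNReal.toReal_ofReal hr0.le, ENNReal.toReal_ofReal (by positivity),
    ← ENNReal.rpow_natCast (_ ^ _), ← ENNReal.rpow_mul]
  simp only [enorm_eq_self]
  congr 2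
  · refine lintegral_congr fun x => ?_
    rw [← ENNReal.rpow_natCast, ← ENNReal.rpow_mul]
    norm_num
  · push_cast
    field_simp

theorem lintegral_enorm_rpow_eq {r : ℝ} (hr : 0 < r) {u : α → ℝ}
    (hfin : eLpNorm u (ENNReal.ofReal r) μ ≠ ⊤) :
    ∫⁻ x, ‖u x‖ₑ ^ r ∂μ = ENNReal.ofReal ((eLpNorm u (ENNReal.ofReal r) μ).toReal ^ r) := by
  rw [← ENNReal.ofReal_rpow_of_nonneg ENNReal.toReal_nonneg hr.le, ENNReal.ofReal_toReal hfin,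
    eLpNorm_eq_lintegral_rpow_enorm_toReal (by simpa using hr) ENNReal.ofReal_ne_top,
    ENNReal.toReal_ofReal hr.le, ← ENNReal.rpow_mul, one_div_mul_cancel hr.ne', ENNReal.rpow_one]

theorem monotoneOn_signed_rpow {r M : ℝ} (hr : 1 < r) (hr2 : r ≤ 2) :
    MonotoneOn (fun t : ℝ => |t| ^ (r - 2) * t - (r - 1) * M ^ (r - 2) * t) (Icc (-M) M) := by
  set g := fun t : ℝ => |t| ^ (r - 2) * t - (r - 1) * M ^ (r - 2) * t with hg
  have hpos : ∀ t, 0 ≤ t → g t = t ^ (r - 1) - (r - 1) * M ^ (r - 2) * t := fun t ht => by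
    simp only [hg, abs_of_nonneg ht]
    rcases ht.eq_or_lt with rfl | ht
    · simp [Real.zero_rpow (by linarith : r - 1 ≠ 0)]
    · rw [← Real.rpow_add_one ht.ne']; ring_nf
  have hodd : ∀ t, g (-t) = - g t := fun t => by simp only [hg, abs_neg]; ring
  have hmono : MonotoneOn g (Icc 0 M) := by
    have h1 : MonotoneOn (fun t : ℝ => t ^ (r - 1) - (r - 1) * M ^ (r - 2) * t) (Icc 0 M) := by
      refine monotoneOn_of_hasDerivWithinAt_nonneg (convex_Icc 0 M)
        (f' := fun t => (r - 1) * t ^ (r - 1 - 1) - (r - 1) * M ^ (r - 2) * 1) ?_ ?_ ?_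
      · exact ((Real.continuous_rpow_const (by linarith)).sub
          (continuous_const.mul continuous_id)).continuousOn
      · intro t ht
        rw [interior_Icc] at ht
        exact ((Real.hasDerivAt_rpow_const (Or.inl ht.1.ne')).sub
          ((hasDerivAt_id t).const_mul _)).hasDerivWithinAt
      · intro t ht
        rw [interior_Icc] at ht
        have : M ^ (r - 2) ≤ t ^ (r - 2) :=
          Real.rpow_le_rpow_of_nonpos ht.1 ht.2.le (by linarith)
        have e : r - 1 - 1 = r - 2 := by ring
        rw [e, mul_one, ← mul_sub]
        exact mul_nonneg (by linarith) (by linarith)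
    intro x hx y hy hxy
    rw [hpos x hx.1, hpos y hy.1]
    exact h1 hx hy hxy
  have h0 : g 0 = 0 := by simp [hg]
  intro x hx y hy hxy
  rcases le_total 0 x with h | h
  · exact hmono ⟨h, hx.2⟩ ⟨h.trans hxy, hy.2⟩ hxy
  rcases le_total 0 y with h' | h'
  · have h1 : g 0 ≤ g y := hmono ⟨le_rfl, by linarith [hy.2]⟩ ⟨h', hy.2⟩ h'
    have h2 : g 0 ≤ g (-x) := hmono ⟨le_rfl, by linarith [hx.1]⟩ ⟨by linarith, by linarith [hx.1]⟩
      (by linarith)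
    rw [hodd] at h2
    linarith
  · have h2 : g (-y) ≤ g (-x) := hmono ⟨by linarith, by linarith [hy.1]⟩
      ⟨by linarith, by linarith [hx.1]⟩ (by linarith)
    rw [hodd, hodd] at h2
    linarith

/-- The Bregman divergence of `|·|^r` controls a weighted square. -/
theorem bregman_abs_rpow {r : ℝ} (hr : 1 < r) (hr2 : r ≤ 2) (a b : ℝ) :
    r * (r - 1) / 2 * ((b - a) ^ 2 * (|a| + |b|) ^ (r - 2)) ≤
      |b| ^ r - |a| ^ r - r * (|a| ^ (r - 2) * a) * (b - a) := by
  set M := |a| + |b| with hM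
  have hmono := monotoneOn_signed_rpow (M := M) hr hr2
  have haM : a ∈ Icc (-M) M := by rw [mem_Icc, ← abs_le]; linarith [abs_nonneg b]
  have hbM : b ∈ Icc (-M) M := by rw [mem_Icc, ← abs_le]; linarith [abs_nonneg a]
  let κ := r * (r - 1) / 2 * M ^ (r - 2)
  let ψ : ℝ → ℝ := fun t => |t| ^ r - κ * t ^ 2
  let ψ' : ℝ → ℝ := fun t => r * (|t| ^ (r - 2) * t - (r - 1) * M ^ (r - 2) * t)
  have hψ : ∀ t, HasDerivAt ψ (ψ' t) t := fun t => by
    refine ((hasDerivAt_abs_rpow t hr).sub ((hasDerivAt_pow 2 t).const_mul κ)).congr_deriv ?_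
    simp only [ψ', κ]; push_cast; ring
  have hψc : Continuous ψ := continuous_iff_continuousAt.2 fun t => (hψ t).continuousAt
  have key : ψ' a * (b - a) ≤ ψ b - ψ a := by
    have hm' : ∀ {x y}, x ∈ Icc (-M) M → y ∈ Icc (-M) M → x ≤ y → ψ' x ≤ ψ' y := fun hx hy hxy =>
      mul_le_mul_of_nonneg_left (hmono hx hy hxy) (by linarith)
    rcases lt_trichotomy a b with h | h | h
    · obtain ⟨c, hc, hce⟩ := exists_hasDerivAt_eq_slope ψ ψ' h hψc.continuousOn fun t _ => hψ t
      rw [eq_div_iff (by linarith)] at hce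
      rw [← hce]
      exact mul_le_mul_of_nonneg_right (hm' haM ⟨by linarith [haM.1, hc.1], by linarith [hbM.2, hc.2]⟩
        hc.1.le) (by linarith)
    · simp [h]
    · obtain ⟨c, hc, hce⟩ := exists_hasDerivAt_eq_slope ψ ψ' h hψc.continuousOn fun t _ => hψ t
      rw [eq_div_iff (by linarith)] at hce
      have := mul_le_mul_of_nonneg_right (hm' (x := c)
        ⟨by linarith [hbM.1, hc.1], by linarith [haM.2, hc.2]⟩ haM hc.2.le)
        (by linarith : 0 ≤ a - b)
      linarith
  simp only [ψ, ψ', κ] at key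
  nlinarith [key]

/-- A quantitative Hölder inequality in the unit ball of `L^r`, `1 < r ≤ 2`. -/
theorem quantitative_holder {r : ℝ} (hr : 1 < r) (hr2 : r ≤ 2) {a b : α → ℝ}
    (ha : MemLp a (ENNReal.ofReal r) μ) (hb : MemLp b (ENNReal.ofReal r) μ)
    (ha1 : eLpNorm a (ENNReal.ofReal r) μ ≤ 1) (hb1 : eLpNorm b (ENNReal.ofReal r) μ ≤ 1)
    (hint : Integrable (fun x => b x * (|a x| ^ (r - 2) * a x)) μ) :
    ENNReal.ofReal ((r - 1) / 2 * 2 ^ (r - 2)) *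
        eLpNorm (fun x => b x - a x) (ENNReal.ofReal r) μ ^ 2 ≤
      ENNReal.ofReal (1 - ∫ x, b x * (|a x| ^ (r - 2) * a x) ∂μ) := by
  have hr0 : 0 < r := by linarith
  have hnorm1 : ∀ {g : α → ℝ}, eLpNorm g (ENNReal.ofReal r) μ ≤ 1 → ∫⁻ x, ‖g x‖ₑ ^ r ∂μ ≤ 1 := by
    intro g hg
    rw [lintegral_enorm_rpow_eq hr0 (ne_top_of_le_ne_top ENNReal.one_ne_top hg)]
    rw [ENNReal.ofReal_le_one]
    refine Real.rpow_le_one ENNReal.toReal_nonneg ?_ hr0.le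
    exact ENNReal.toReal_le_of_le_ofReal zero_le_one (by simpa using hg)
  have hI : ∀ {g : α → ℝ}, MemLp g (ENNReal.ofReal r) μ → Integrable (fun x => |g x| ^ r) μ := by
    intro g hg
    have := hg.integrable_norm_rpow (by simpa using hr0) ENNReal.ofReal_ne_top
    simpa [ENNReal.toReal_ofReal hr0.le] using this
  have hI1 : ∀ {g : α → ℝ}, MemLp g (ENNReal.ofReal r) μ → eLpNorm g (ENNReal.ofReal r) μ ≤ 1 →
      ∫ x, |g x| ^ r ∂μ ≤ 1 := by
    intro g hg h1
    rw [integral_eq_lintegral_of_nonneg_ae (Eventually.of_forall fun x => by positivity)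
      (hI hg).aestronglyMeasurable]
    refine ENNReal.toReal_le_of_le_ofReal zero_le_one ?_
    rw [ENNReal.ofReal_one]
    refine le_trans (lintegral_mono fun x => ?_) (hnorm1 h1)
    rw [← ofReal_norm, ENNReal.ofReal_rpow_of_nonneg (norm_nonneg _) hr0.le, Real.norm_eq_abs]
  have hA := hI1 ha ha1
  have hB := hI1 hb hb1
  set I := ∫ x, b x * (|a x| ^ (r - 2) * a x) ∂μ with hIdef
  have haa : ∀ t : ℝ, |t| ^ (r - 2) * t * t = |t| ^ r := fun t => by
    rcases eq_or_ne t 0 with rfl | ht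
    · simp [Real.zero_rpow hr0.ne']
    · rw [mul_assoc, ← sq, ← sq_abs, ← Real.rpow_natCast, ← Real.rpow_add (abs_pos.2 ht)]
      norm_num
  let D : α → ℝ := fun x => (b x - a x) ^ 2 * (|a x| + |b x|) ^ (r - 2)
  have hDm : AEStronglyMeasurable D μ := by
    have h1 := ha.aestronglyMeasurable.aemeasurable
    have h2 := hb.aestronglyMeasurable.aemeasurable
    exact (((h2.sub h1).pow_const 2).mul
      ((h1.abs.add h2.abs).pow_const (r - 2))).aestronglyMeasurable
  have hD0 : ∀ x, 0 ≤ D x := fun x => by simp only [D]; positivity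
  have hbreg : ∀ x, r * (r - 1) / 2 * D x ≤
      |b x| ^ r + (r - 1) * |a x| ^ r - r * (b x * (|a x| ^ (r - 2) * a x)) := fun x => by
    have h1 := bregman_abs_rpow hr hr2 (a x) (b x)
    have h2 := haa (a x)
    simp only [D]
    linear_combination h1 + r * h2
  have hR : Integrable (fun x => |b x| ^ r + (r - 1) * |a x| ^ r
      - r * (b x * (|a x| ^ (r - 2) * a x))) μ :=
    ((hI hb).add ((hI ha).const_mul _)).sub (hint.const_mul _)
  have hlD : ∫⁻ x, ENNReal.ofReal (D x) ∂μ ≤ ENNReal.ofReal (2 / (r - 1) * (1 - I)) := by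
    have hk : 0 < r * (r - 1) / 2 := div_pos (mul_pos hr0 (by linarith)) two_pos
    have hRI : ∫ x, (|b x| ^ r + (r - 1) * |a x| ^ r - r * (b x * (|a x| ^ (r - 2) * a x))) ∂μ
        ≤ r * (1 - I) := by
      rw [integral_sub (by exact (hI hb).add ((hI ha).const_mul _)) (hint.const_mul _),
        integral_add (hI hb) ((hI ha).const_mul _), integral_const_mul, integral_const_mul, ← hIdef]
      nlinarith
    have hle : ∀ x, ENNReal.ofReal (D x) ≤ ENNReal.ofReal ((r * (r - 1) / 2)⁻¹ *
        (|b x| ^ r + (r - 1) * |a x| ^ r - r * (b x * (|a x| ^ (r - 2) * a x)))) := fun x => by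
      refine ENNReal.ofReal_le_ofReal ?_
      rw [← div_eq_inv_mul, le_div_iff₀' hk]
      exact hbreg x
    refine (lintegral_mono hle).trans ?_
    rw [← ofReal_integral_eq_lintegral_ofReal (hR.const_mul _) (Eventually.of_forall fun x =>
      mul_nonneg (inv_nonneg.2 hk.le) ((mul_nonneg hk.le (hD0 x)).trans (hbreg x))),
      integral_const_mul]
    refine ENNReal.ofReal_le_ofReal ?_
    rw [← div_eq_inv_mul, div_le_iff₀ hk]
    have : 2 / (r - 1) * (1 - I) * (r * (r - 1) / 2) = r * (1 - I) := by
      have : r - 1 ≠ 0 := by linarith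
      field_simp
    rw [this]
    exact hRI
  let S : α → ℝ≥0∞ := fun x => ENNReal.ofReal ((|a x| + |b x|) ^ r)
  have hS : ∫⁻ x, S x ∂μ ≤ ENNReal.ofReal (2 ^ r) := by
    have hle : ∀ x, S x ≤ ENNReal.ofReal (2 ^ (r - 1)) * (‖a x‖ₑ ^ r + ‖b x‖ₑ ^ r) := fun x => by
      rw [← ofReal_norm, ← ofReal_norm, ENNReal.ofReal_rpow_of_nonneg (norm_nonneg _) hr0.le,
        ENNReal.ofReal_rpow_of_nonneg (norm_nonneg _) hr0.le, ← ENNReal.ofReal_add (by positivity)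
        (by positivity), ← ENNReal.ofReal_mul (by positivity)]
      exact ENNReal.ofReal_le_ofReal
        (NNReal.rpow_add_le_mul_rpow_add_rpow ⟨|a x|, abs_nonneg _⟩ ⟨|b x|, abs_nonneg _⟩ hr.le)
    refine (lintegral_mono hle).trans ?_
    rw [lintegral_const_mul' _ _ ENNReal.ofReal_ne_top,
      lintegral_add_left' (ha.aestronglyMeasurable.enorm.pow_const r)]
    have e : (2 : ℝ) ^ r = 2 ^ (r - 1) * 2 := by
      rw [← Real.rpow_add_one two_ne_zero]; norm_num
    rw [e, ENNReal.ofReal_mul (by positivity)]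
    gcongr
    refine (add_le_add (hnorm1 ha1) (hnorm1 hb1)).trans_eq ?_
    norm_num
  have hpt : ∀ x, ‖b x - a x‖ₑ ^ r ≤ ENNReal.ofReal (D x) ^ (r / 2) * S x ^ ((2 - r) / 2) :=
      fun x => by
    rw [← ofReal_norm, ENNReal.ofReal_rpow_of_nonneg (norm_nonneg _) hr0.le,
      ENNReal.ofReal_rpow_of_nonneg (hD0 x) (by positivity),
      ENNReal.ofReal_rpow_of_nonneg (by positivity) (by linarith),
      ← ENNReal.ofReal_mul (Real.rpow_nonneg (hD0 x) _)]
    refine ENNReal.ofReal_le_ofReal ?_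
    set T := |a x| + |b x| with hT
    have hT0 : 0 ≤ T := by positivity
    rcases hT0.eq_or_lt with h | h
    · have h1 : a x = 0 := abs_eq_zero.1 (by linarith [abs_nonneg (a x), abs_nonneg (b x)])
      have h2 : b x = 0 := abs_eq_zero.1 (by linarith [abs_nonneg (a x), abs_nonneg (b x)])
      simp only [h1, h2, sub_self, norm_zero, Real.zero_rpow hr0.ne', D]
      positivity
    · simp only [D]
      rw [← hT, Real.mul_rpow (by positivity) (by positivity), ← Real.rpow_mul hT0,
        ← Real.rpow_mul hT0, mul_assoc, ← Real.rpow_add h, ← sq_abs, ← Real.rpow_natCast,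
        ← Real.rpow_mul (abs_nonneg _), Real.norm_eq_abs]
      have e1 : (r - 2) * (r / 2) + r * ((2 - r) / 2) = 0 := by ring
      have e2 : ((2 : ℕ) : ℝ) * (r / 2) = r := by push_cast; ring
      rw [e1, e2, Real.rpow_zero, mul_one]
  have hfinal : ∫⁻ x, ‖b x - a x‖ₑ ^ r ∂μ ≤
      ENNReal.ofReal (2 / (r - 1) * (1 - I)) ^ (r / 2) * ENNReal.ofReal (2 ^ r) ^ ((2 - r) / 2) := by
    refine (lintegral_mono hpt).trans ?_
    refine (ENNReal.lintegral_mul_norm_pow_le (hDm.aemeasurable.ennreal_ofReal)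
      ?_ (by positivity) (by linarith) (by ring)).trans ?_
    · exact (((ha.aestronglyMeasurable.aemeasurable.abs.add
        hb.aestronglyMeasurable.aemeasurable.abs).pow_const r)).ennreal_ofReal
    · gcongr
  have hN : eLpNorm (fun x => b x - a x) (ENNReal.ofReal r) μ ^ 2 ≤
      ENNReal.ofReal (2 / (r - 1) * (1 - I)) * ENNReal.ofReal (2 ^ (2 - r)) := by
    rw [eLpNorm_eq_lintegral_rpow_enorm_toReal (by simpa using hr0) ENNReal.ofReal_ne_top,
      ENNReal.toReal_ofReal hr0.le, ← ENNReal.rpow_natCast, ← ENNReal.rpow_mul]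
    refine (ENNReal.rpow_le_rpow hfinal (by positivity)).trans_eq ?_
    rw [ENNReal.mul_rpow_of_nonneg _ _ (by positivity), ← ENNReal.rpow_mul, ← ENNReal.rpow_mul]
    have e1 : r / 2 * (1 / r * ((2 : ℕ) : ℝ)) = 1 := by push_cast; field_simp
    have e2 : (2 - r) / 2 * (1 / r * ((2 : ℕ) : ℝ)) = (2 - r) / r := by push_cast; field_simp
    rw [e1, e2, ENNReal.rpow_one, ENNReal.ofReal_rpow_of_nonneg (by positivity)
      (div_nonneg (by linarith) hr0.le), ← Real.rpow_mul (by norm_num), mul_div_cancel₀ _ hr0.ne']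
  refine (mul_le_mul_right hN _).trans_eq ?_
  rw [mul_comm (ENNReal.ofReal (2 / (r - 1) * (1 - I))), ← mul_assoc,
    ← ENNReal.ofReal_mul (mul_nonneg (by linarith) (by positivity)),
    ← ENNReal.ofReal_mul (mul_nonneg (mul_nonneg (by linarith) (by positivity)) (by positivity))]
  congr 1
  have : (2 : ℝ) ^ (r - 2) * 2 ^ (2 - r) = 1 := by
    rw [← Real.rpow_add two_pos]; norm_num
  have h1 : r - 1 ≠ 0 := by linarith
  calc (r - 1) / 2 * 2 ^ (r - 2) * 2 ^ (2 - r) * (2 / (r - 1) * (1 - I))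
      = ((2 : ℝ) ^ (r - 2) * 2 ^ (2 - r)) * (1 - I) := by field_simp
    _ = 1 - I := by rw [this, one_mul]

end Inequalities

end

section

variable {N : ℕ} [hN : Fact (3 ≤ N)] {Ω : Set (Eucl N)} {f : W012 Ω →ₗ[ℝ] ℝ} {p : ℝ}

/-- The part `½ ∫ |∇u|^2 - ⟨f, u⟩` common to all the functionals. -/
def quadPart (f : W012 Ω →ₗ[ℝ] ℝ) (u : W012 Ω) : ℝ := 1 / 2 * ‖gradOf u‖ ^ 2 - f u

theorem gradOf_add (u v : W012 Ω) : gradOf (u + v) = gradOf u + gradOf v := rfl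

theorem gradOf_sub (u v : W012 Ω) : gradOf (u - v) = gradOf u - gradOf v := rfl

theorem gradOf_smul (c : ℝ) (u : W012 Ω) : gradOf (c • u) = c • gradOf u := rfl

theorem fnOf_add (u v : W012 Ω) : fnOf (u + v) =ᵐ[vol Ω] fun x => fnOf u x + fnOf v x :=
  Lp.coeFn_add u.1.1 v.1.1

theorem fnOf_smul (c : ℝ) (u : W012 Ω) : fnOf (c • u) =ᵐ[vol Ω] fun x => c * fnOf u x :=
  Lp.coeFn_smul c u.1.1

theorem fnOf_combination (s t : ℝ) (u v : W012 Ω) :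
    fnOf (s • u + t • v) =ᵐ[vol Ω] fun x => s * fnOf u x + t * fnOf v x := by
  filter_upwards [fnOf_add (s • u) (t • v), fnOf_smul s u, fnOf_smul t v] with x h1 h2 h3
  rw [h1, h2, h3]

theorem quadPart_combination (f : W012 Ω →ₗ[ℝ] ℝ) (t : ℝ) (u v : W012 Ω) :
    quadPart f ((1 - t) • u + t • v) = (1 - t) * quadPart f u + t * quadPart f v
      - t * (1 - t) / 2 * ‖gradOf u - gradOf v‖ ^ 2 := by
  simp only [quadPart, gradOf_add, gradOf_smul, map_add, map_smul, smul_eq_mul]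
  rw [norm_add_sq_real, norm_sub_sq_real, inner_smul_left, inner_smul_right, norm_smul, norm_smul,
    mul_pow, mul_pow, Real.norm_eq_abs, Real.norm_eq_abs, sq_abs, sq_abs]
  simp only [conj_trivial]
  ring

theorem tendsto_dual (hf : MemDual f) {u : ℕ → W012 Ω} {v : W012 Ω}
    (h : Tendsto (fun n => gradOf (u n)) atTop (𝓝 (gradOf v))) :
    Tendsto (fun n => f (u n)) atTop (𝓝 (f v)) := by
  obtain ⟨C, hC⟩ := hf
  rw [tendsto_iff_norm_sub_tendsto_zero] at h ⊢
  have h' := h.const_mul C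
  rw [mul_zero] at h'
  refine squeeze_zero (fun n => norm_nonneg _) (fun n => ?_) h'
  rw [← map_sub, ← gradOf_sub]
  exact hC _

theorem tendsto_quadPart (hf : MemDual f) {u : ℕ → W012 Ω} {v : W012 Ω}
    (h : Tendsto (fun n => gradOf (u n)) atTop (𝓝 (gradOf v))) :
    Tendsto (fun n => quadPart f (u n)) atTop (𝓝 (quadPart f v)) :=
  ((h.norm.pow 2).const_mul _).sub (tendsto_dual hf h)

/-- Coercivity of `½ κ |∇u|^2 - ⟨f, u⟩`. -/
theorem coercive_bound (hf : MemDual f) {κ : ℝ} (hκ : 0 < κ) :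
    ∃ B : ℝ, ∀ u, B ≤ κ / 2 * ‖gradOf u‖ ^ 2 - f u := by
  obtain ⟨C, hC⟩ := hf
  refine ⟨-(C ^ 2 / (2 * κ)), fun u => ?_⟩
  have h1 := (le_abs_self _).trans (hC u)
  have h2 : κ / 2 * ‖gradOf u‖ ^ 2 - C * ‖gradOf u‖ + C ^ 2 / (2 * κ) =
      κ / 2 * (‖gradOf u‖ - C / κ) ^ 2 := by field_simp; ring
  have h3 : 0 ≤ κ / 2 * (‖gradOf u‖ - C / κ) ^ 2 := by positivity
  linarith

theorem exists_tendsto_of_cauchySeq_gradOf {u : ℕ → W012 Ω}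
    (h : CauchySeq fun n => gradOf (u n)) : ∃ v : W012 Ω, Tendsto u atTop (𝓝 v) := by
  obtain ⟨S, hS, hSob⟩ := exists_sobolev_bound N
  have : CompleteSpace (W012 Ω) :=
    (isClosed_closure (s := (testPairs Ω : Set (PairSpace Ω)))).completeSpace_coe
  refine cauchySeq_tendsto_of_complete ?_
  rw [Metric.cauchySeq_iff] at h ⊢
  intro ε hε
  obtain ⟨n₀, hn₀⟩ := h (ε / (S + 1)) (by positivity)
  refine ⟨n₀, fun m hm n hn => ?_⟩
  have h1 := hn₀ m hm n hn
  rw [dist_eq_norm, ← gradOf_sub, lt_div_iff₀ (by positivity)] at h1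
  rw [dist_eq_norm]
  refine lt_of_le_of_lt ?_ h1
  change max ‖fnOf (u m - u n)‖ ‖gradOf (u m - u n)‖ ≤ _
  have h2 := hSob Ω (u m - u n)
  have h3 := norm_nonneg (gradOf (u m - u n))
  refine max_le ?_ ?_ <;> nlinarith

theorem two_lt_dualExp (hp : 1 < p) : 2 < 2 * p / (p - 1) := by
  rw [lt_div_iff₀ (by linarith)]; linarith

theorem one_le_dualExp (hp : 1 < p) : 1 ≤ ENNReal.ofReal (2 * p / (p - 1)) := by
  rw [ENNReal.one_le_ofReal]; linarith [two_lt_dualExp hp]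

theorem dualNorm_combination_le (hp : 1 < p) (s t : ℝ) (u v : W012 Ω) :
    dualNorm p (s • u + t • v) ≤ ‖s‖ₑ * dualNorm p u + ‖t‖ₑ * dualNorm p v := by
  rw [dualNorm, eLpNorm_congr_ae (fnOf_combination s t u v), dualNorm, dualNorm]
  refine (eLpNorm_add_le ((Lp.aestronglyMeasurable (fnOf u)).const_mul s)
    ((Lp.aestronglyMeasurable (fnOf v)).const_mul t) (one_le_dualExp hp)).trans ?_
  exact add_le_add (eLpNorm_const_smul s (fnOf u : Eucl N → ℝ) _ _).le
    (eLpNorm_const_smul t (fnOf v : Eucl N → ℝ) _ _).le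

theorem dualNorm_combination_lt_top (hp : 1 < p) (s t : ℝ) {u v : W012 Ω}
    (hu : dualNorm p u < ⊤) (hv : dualNorm p v < ⊤) : dualNorm p (s • u + t • v) < ⊤ :=
  (dualNorm_combination_le hp s t u v).trans_lt (ENNReal.add_lt_top.2
    ⟨ENNReal.mul_lt_top enorm_lt_top hu, ENNReal.mul_lt_top enorm_lt_top hv⟩)

theorem toReal_dualNorm_combination_le (hp : 1 < p) (s t : ℝ) {u v : W012 Ω}
    (hu : dualNorm p u < ⊤) (hv : dualNorm p v < ⊤) : (dualNorm p (s • u + t • v)).toReal ≤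
      |s| * (dualNorm p u).toReal + |t| * (dualNorm p v).toReal := by
  have h := ENNReal.toReal_mono (ENNReal.add_ne_top.2
    ⟨(ENNReal.mul_lt_top (enorm_lt_top (x := s)) hu).ne,
      (ENNReal.mul_lt_top (enorm_lt_top (x := t)) hv).ne⟩) (dualNorm_combination_le hp s t u v)
  rw [ENNReal.toReal_add (ENNReal.mul_lt_top enorm_lt_top hu).ne
    (ENNReal.mul_lt_top enorm_lt_top hv).ne, ENNReal.toReal_mul, ENNReal.toReal_mul] at h
  simpa using h

theorem dualNorm_zero : dualNorm p (0 : W012 Ω) = 0 := by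
  have h : fnOf (0 : W012 Ω) =ᵐ[vol Ω] 0 := Lp.coeFn_zero ℝ (sobolevExp N) (vol Ω)
  rw [dualNorm, eLpNorm_congr_ae h, eLpNorm_zero]

/-- The finite values of `G_{p,f}`. -/
def realG (p : ℝ) (f : W012 Ω →ₗ[ℝ] ℝ) (u : W012 Ω) : ℝ :=
  quadPart f u + 1 / 2 * (dualNorm p u).toReal ^ 2

theorem functionalG_eq_coe {u : W012 Ω} (hu : dualNorm p u < ⊤) :
    functionalG p f u = (realG p f u : EReal) := by
  have h : (2⁻¹ * dualNorm p u ^ 2 : ℝ≥0∞) ≠ ⊤ :=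
    ENNReal.mul_ne_top (by simp) (ENNReal.pow_ne_top hu.ne)
  rw [functionalG, realG, EReal.coe_add, ← EReal.coe_ennreal_toReal h]
  simp [quadPart]

theorem functionalG_eq_top {u : W012 Ω} (hu : dualNorm p u = ⊤) : functionalG p f u = ⊤ := by
  rw [functionalG, hu, ENNReal.top_pow two_ne_zero, ENNReal.mul_top (by simp),
    EReal.coe_ennreal_top, EReal.coe_add_top]

theorem dualNorm_lt_top_of_isMinimizerG {v : W012 Ω} (hv : IsMinimizerG p f v) :
    dualNorm p v < ⊤ := by
  by_contra! h
  have h1 := hv 0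
  rw [functionalG_eq_top (top_le_iff.1 h), functionalG_eq_coe (by rw [dualNorm_zero]; simp)] at h1
  exact absurd (top_le_iff.1 h1) (EReal.coe_ne_top _)

theorem isMinimizerG_iff {v : W012 Ω} (hv : dualNorm p v < ⊤) :
    IsMinimizerG p f v ↔ ∀ u, dualNorm p u < ⊤ → realG p f v ≤ realG p f u := by
  constructor
  · intro h u hu
    have := h u
    rwa [functionalG_eq_coe hv, functionalG_eq_coe hu, EReal.coe_le_coe_iff] at this
  · intro h u
    rcases eq_or_ne (dualNorm p u) ⊤ with hu | hu
    · rw [functionalG_eq_top hu]; exact le_top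
    · rw [functionalG_eq_coe hv, functionalG_eq_coe hu.lt_top, EReal.coe_le_coe_iff]
      exact h u hu.lt_top

/-- Uniform convexity of `G_{p,f}`. -/
theorem realG_midpoint_le (hp : 1 < p) {u v : W012 Ω} (hu : dualNorm p u < ⊤)
    (hv : dualNorm p v < ⊤) :
    realG p f ((1 - 1 / 2 : ℝ) • u + (1 / 2 : ℝ) • v) ≤
      1 / 2 * realG p f u + 1 / 2 * realG p f v - 1 / 8 * ‖gradOf u - gradOf v‖ ^ 2 := by
  have h1 := toReal_dualNorm_combination_le hp (1 - 1 / 2) (1 / 2) hu hv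
  rw [realG, quadPart_combination, realG, realG]
  rw [abs_of_nonneg (by norm_num), abs_of_nonneg (by norm_num)] at h1
  have h2 := pow_le_pow_left₀ ENNReal.toReal_nonneg h1 2
  nlinarith [sq_nonneg ((dualNorm p u).toReal - (dualNorm p v).toReal)]

theorem existsUnique_isMinimizerG (hp : 1 < p) (hf : MemDual f) :
    ∃! v : W012 Ω, IsMinimizerG p f v := by
  let A : Set ℝ := realG p f '' {u | dualNorm p u < ⊤}
  have hA : A.Nonempty := ⟨_, 0, by rw [mem_ofPred_eq, dualNorm_zero]; simp, rfl⟩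
  have hAb : BddBelow A := by
    obtain ⟨B, hB⟩ := coercive_bound hf one_pos
    refine ⟨B, ?_⟩
    rintro _ ⟨u, _, rfl⟩
    have := hB u
    simp only [realG, quadPart]
    nlinarith [sq_nonneg (dualNorm p u).toReal]
  have hgap : ∀ {u v : W012 Ω}, dualNorm p u < ⊤ → dualNorm p v < ⊤ →
      ‖gradOf u - gradOf v‖ ^ 2 ≤ 4 * (realG p f u + realG p f v - 2 * sInf A) := by
    intro u v hu hv
    have h1 := realG_midpoint_le (f := f) hp hu hv
    have h2 : sInf A ≤ realG p f ((1 - 1 / 2 : ℝ) • u + (1 / 2 : ℝ) • v) :=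
      csInf_le hAb ⟨_, dualNorm_combination_lt_top hp _ _ hu hv, rfl⟩
    linarith
  obtain ⟨S, hS, hSob⟩ := exists_sobolev_bound N
  have huniq : ∀ {v w : W012 Ω}, IsMinimizerG p f v → IsMinimizerG p f w → v = w := by
    intro v w hv hw
    have hv' := dualNorm_lt_top_of_isMinimizerG hv
    have hw' := dualNorm_lt_top_of_isMinimizerG hw
    have e : ∀ {z : W012 Ω}, IsMinimizerG p f z → realG p f z ≤ sInf A := by
      intro z hz
      refine le_csInf hA ?_
      rintro _ ⟨u, hu, rfl⟩
      exact (isMinimizerG_iff (dualNorm_lt_top_of_isMinimizerG hz)).1 hz u hu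
    have h1 := hgap hv' hw'
    have h2 : ‖gradOf v - gradOf w‖ = 0 := by
      have : ‖gradOf v - gradOf w‖ ^ 2 ≤ 0 := by linarith [e hv, e hw]
      exact pow_eq_zero_iff two_ne_zero |>.1 (le_antisymm this (sq_nonneg _))
    have h3 := hSob Ω (v - w)
    rw [gradOf_sub, h2, mul_zero] at h3
    have h4 : fnOf v - fnOf w = 0 := norm_le_zero_iff.1 h3
    exact Subtype.ext (Prod.ext (sub_eq_zero.1 h4) (sub_eq_zero.1 (norm_eq_zero.1 h2)))
  obtain ⟨g, -, hglim, hgA⟩ := exists_seq_tendsto_sInf hA hAb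
  choose u hu hug using hgA
  have hcauchy : CauchySeq fun n => gradOf (u n) := by
    rw [Metric.cauchySeq_iff]
    intro ε hε
    obtain ⟨n₀, hn₀⟩ := eventually_atTop.1
      (hglim.eventually (gt_mem_nhds (show sInf A < sInf A + ε ^ 2 / 8 by linarith [pow_pos hε 2])))
    refine ⟨n₀, fun m hm n hn => ?_⟩
    have h1 := hgap (hu m) (hu n)
    rw [hug, hug] at h1
    rw [dist_eq_norm]
    refine lt_of_pow_lt_pow_left₀ 2 hε.le ?_
    linarith [hn₀ m hm, hn₀ n hn]
  obtain ⟨v, hv⟩ := exists_tendsto_of_cauchySeq_gradOf hcauchy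
  have hv1 : Tendsto (fun n => (u n).1) atTop (𝓝 v.1) := (continuous_subtype_val.tendsto v).comp hv
  have hgrad : Tendsto (fun n => gradOf (u n)) atTop (𝓝 (gradOf v)) :=
    (continuous_snd.tendsto _).comp hv1
  have hfn : Tendsto (fun n => fnOf (u n)) atTop (𝓝 (fnOf v)) :=
    (continuous_fst.tendsto _).comp hv1
  obtain ⟨ns, hns, hae⟩ := exists_subseq_ae hfn
  have hd : ∀ n, dualNorm p (u n) = ENNReal.ofReal (√(2 * (g n - quadPart f (u n)))) := by
    intro n
    have : 2 * (g n - quadPart f (u n)) = (dualNorm p (u n)).toReal ^ 2 := by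
      rw [← hug n, realG]; ring
    rw [this, Real.sqrt_sq ENNReal.toReal_nonneg, ENNReal.ofReal_toReal (hu n).ne]
  set ℓ := 2 * (sInf A - quadPart f v) with hℓ
  have hdlim : Tendsto (fun n => dualNorm p (u n)) atTop (𝓝 (ENNReal.ofReal (√ℓ))) := by
    simp_rw [hd]
    exact ENNReal.tendsto_ofReal ((Real.continuous_sqrt.tendsto _).comp
      ((hglim.sub (tendsto_quadPart hf hgrad)).const_mul 2))
  have hlsc : dualNorm p v ≤ ENNReal.ofReal (√ℓ) := by
    refine (Lp.eLpNorm_lim_le_liminf_eLpNorm (fun n => Lp.aestronglyMeasurable (fnOf (u (ns n))))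
      _ hae).trans_eq ?_
    exact (hdlim.comp hns.tendsto_atTop).liminf_eq
  have hvfin : dualNorm p v < ⊤ := hlsc.trans_lt ENNReal.ofReal_lt_top
  have hℓ0 : 0 ≤ ℓ := by
    refine ge_of_tendsto' ((hglim.sub (tendsto_quadPart hf hgrad)).const_mul 2) fun n => ?_
    rw [← hug n, realG]
    have := sq_nonneg (dualNorm p (u n)).toReal
    linarith
  have hmin : IsMinimizerG p f v := by
    rw [isMinimizerG_iff hvfin]
    intro w hw
    refine le_trans ?_ (csInf_le hAb ⟨w, hw, rfl⟩)
    have h1 := ENNReal.toReal_le_of_le_ofReal (Real.sqrt_nonneg _) hlsc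
    have h2 := pow_le_pow_left₀ ENNReal.toReal_nonneg h1 2
    rw [Real.sq_sqrt hℓ0] at h2
    rw [realG]
    linarith
  exact ⟨v, hmin, fun w hw => huniq hw hmin⟩

theorem dualNorm_pos_of_isMinimizerG (hΩ : IsOpen Ω) (hp : 1 < p) (hf : MemDual f) (hf0 : f ≠ 0)
    {v : W012 Ω} (hv : IsMinimizerG p f v) : 0 < dualNorm p v := by
  rw [pos_iff_ne_zero]
  intro h0
  have hq0 : ENNReal.ofReal (2 * p / (p - 1)) ≠ 0 :=
    (zero_lt_one.trans_le (one_le_dualExp hp)).ne'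
  have hfn : fnOf v = 0 := by
    rw [Lp.eq_zero_iff_ae_eq_zero]
    exact (eLpNorm_eq_zero_iff (Lp.aestronglyMeasurable _) hq0).1 h0
  have hv0 : v = 0 := fnOf_injective hΩ (v := 0) hfn
  subst hv0
  have hle := (isMinimizerG_iff (by rw [dualNorm_zero]; simp)).1 hv
  have hz : ∀ w : W012 Ω, dualNorm p w < ⊤ → f w = 0 := by
    intro w hw
    set K := 1 / 2 * ‖gradOf w‖ ^ 2 + 1 / 2 * (dualNorm p w).toReal ^ 2 with hK
    have hK0 : 0 ≤ K := by positivity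
    have hfin : ∀ t : ℝ, 0 ≤ t ^ 2 * K - t * f w := fun t => by
      have h1 := hle (t • w + (0 : ℝ) • w) (dualNorm_combination_lt_top hp _ _ hw hw)
      have h2 := toReal_dualNorm_combination_le hp t 0 hw hw
      rw [abs_zero, zero_mul, add_zero] at h2
      have h3 := pow_le_pow_left₀ ENNReal.toReal_nonneg h2 2
      rw [mul_pow, sq_abs] at h3
      have hg0 : gradOf (0 : W012 Ω) = 0 := rfl
      simp only [realG, quadPart, dualNorm_zero, hg0, map_zero] at h1
      have h4 : ‖gradOf (t • w + (0 : ℝ) • w)‖ ^ 2 = t ^ 2 * ‖gradOf w‖ ^ 2 := by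
        rw [zero_smul, add_zero, gradOf_smul, norm_smul, mul_pow, Real.norm_eq_abs, sq_abs]
      rw [h4] at h1
      simp only [map_add, map_smul, smul_eq_mul] at h1
      rw [norm_zero, ENNReal.toReal_zero] at h1
      linear_combination h1 + 1 / 2 * h3
    by_contra hne
    have hsq : 0 < f w ^ 2 := by positivity
    have h1 := hfin (f w / (2 * (K + 1)))
    have h2 : (f w / (2 * (K + 1))) ^ 2 * K - f w / (2 * (K + 1)) * f w =
        - (f w ^ 2 * (K + 2) / (4 * (K + 1) ^ 2)) := by field_simp; ring
    rw [h2] at h1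
    have h3 : 0 < f w ^ 2 * (K + 2) / (4 * (K + 1) ^ 2) := by positivity
    linarith
  refine hf0 (LinearMap.ext fun u => ?_)
  obtain ⟨w, L, hw, hgrad, -, -⟩ := exists_truncation hΩ u
  have h1 := tendsto_dual hf hgrad
  have h2 : ∀ n, f (w n) = 0 := fun n => hz _ (hw n _ (by linarith [two_lt_dualExp hp]))
  simp_rw [h2] at h1
  simpa using (tendsto_nhds_unique h1 tendsto_const_nhds)

end

section

/-- The potential in the ball of `L^p` which is extremal in Hölder's inequality for
`∫ V u^2`, where `c` is the norm of `u` in `L^{2p/(p-1)}`. -/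
def optPot {α : Type*} (p c : ℝ) (u : α → ℝ) (x : α) : ℝ := (|u x| / c) ^ (2 / (p - 1))

section OptimalPotential

variable {α : Type*} {m : MeasurableSpace α} {μ : Measure α} {p c : ℝ} {u : α → ℝ}

theorem optPot_nonneg (hc : 0 ≤ c) (x : α) : 0 ≤ optPot p c u x := by
  unfold optPot; positivity

theorem measurable_optPot (hu : Measurable u) : Measurable (optPot p c u) :=
  ((hu.abs).div_const c).pow_const _

theorem optPot_mul_sq (hp : 1 < p) (hc : 0 < c) (x : α) :
    optPot p c u x * |u x| ^ 2 = c ^ 2 * (|u x| / c) ^ (2 * p / (p - 1)) := by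
  have h1 : p - 1 ≠ 0 := by linarith
  have h2 : 2 * p / (p - 1) = 2 / (p - 1) + 2 := by field_simp; ring
  rw [h2, Real.rpow_add_of_nonneg (by positivity) (div_nonneg two_pos.le (by linarith)) two_pos.le,
    Real.rpow_two, optPot]
  field_simp

theorem optPot_rpow (hc : 0 < c) (x : α) :
    optPot p c u x ^ p = (|u x| / c) ^ (2 * p / (p - 1)) := by
  rw [optPot, ← Real.rpow_mul (by positivity)]
  congr 1
  ring

theorem lintegral_div_rpow (hp : 1 < p) (hc : c = (eLpNorm u (ENNReal.ofReal (2 * p / (p - 1))) μ).toReal)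
    (hc0 : 0 < c) : ∫⁻ x, ENNReal.ofReal ((|u x| / c) ^ (2 * p / (p - 1))) ∂μ = 1 := by
  have hq : 0 < 2 * p / (p - 1) := by linarith [two_lt_dualExp hp]
  have hfin : eLpNorm u (ENNReal.ofReal (2 * p / (p - 1))) μ ≠ ⊤ := fun h => by
    rw [h] at hc; simp at hc; linarith
  have h1 : ∀ x, ENNReal.ofReal ((|u x| / c) ^ (2 * p / (p - 1))) =
      ENNReal.ofReal ((c ^ (2 * p / (p - 1)))⁻¹) * ‖u x‖ₑ ^ (2 * p / (p - 1)) := fun x => by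
    rw [← ofReal_norm, ENNReal.ofReal_rpow_of_nonneg (norm_nonneg _) hq.le,
      ← ENNReal.ofReal_mul (by positivity), Real.div_rpow (abs_nonneg _) hc0.le, div_eq_inv_mul,
      Real.norm_eq_abs]
  simp_rw [h1]
  rw [lintegral_const_mul' _ _ ENNReal.ofReal_ne_top, lintegral_enorm_rpow_eq hq hfin, ← hc,
    ← ENNReal.ofReal_mul (by positivity), inv_mul_cancel₀ (by positivity), ENNReal.ofReal_one]

theorem lintegral_optPot_mul_self (hp : 1 < p)
    (hc : c = (eLpNorm u (ENNReal.ofReal (2 * p / (p - 1))) μ).toReal) (hc0 : 0 < c) :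
    ∫⁻ x, ENNReal.ofReal (optPot p c u x) * ‖u x‖ₑ ^ 2 ∂μ = ENNReal.ofReal (c ^ 2) := by
  have h1 : ∀ x, ENNReal.ofReal (optPot p c u x) * ‖u x‖ₑ ^ 2 =
      ENNReal.ofReal (c ^ 2) * ENNReal.ofReal ((|u x| / c) ^ (2 * p / (p - 1))) := fun x => by
    rw [← ofReal_norm, ← ENNReal.ofReal_pow (norm_nonneg _), Real.norm_eq_abs,
      ← ENNReal.ofReal_mul (optPot_nonneg hc0.le x), optPot_mul_sq hp hc0,
      ENNReal.ofReal_mul (by positivity)]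
  simp_rw [h1]
  rw [lintegral_const_mul' _ _ ENNReal.ofReal_ne_top, lintegral_div_rpow hp hc hc0, mul_one]

theorem eLpNorm_optPot (hp : 1 < p)
    (hc : c = (eLpNorm u (ENNReal.ofReal (2 * p / (p - 1))) μ).toReal) (hc0 : 0 < c) :
    eLpNorm (fun x => ENNReal.ofReal (optPot p c u x)) (ENNReal.ofReal p) μ = 1 := by
  have hp0 : 0 < p := by linarith
  rw [eLpNorm_eq_lintegral_rpow_enorm_toReal (by simpa using hp0) ENNReal.ofReal_ne_top,
    ENNReal.toReal_ofReal hp0.le]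
  have h1 : ∀ x, ‖ENNReal.ofReal (optPot p c u x)‖ₑ ^ p =
      ENNReal.ofReal ((|u x| / c) ^ (2 * p / (p - 1))) := fun x => by
    rw [enorm_eq_self, ENNReal.ofReal_rpow_of_nonneg (optPot_nonneg hc0.le x) hp0.le,
      optPot_rpow hc0]
  simp_rw [h1]
  rw [lintegral_div_rpow hp hc hc0, ENNReal.one_rpow]

theorem lintegral_ball_mul_sq_le (hp : 1 < p) {W : α → ℝ≥0∞} (hW : AEMeasurable W μ)
    (hW1 : eLpNorm W (ENNReal.ofReal p) μ ≤ 1) (hu : AEStronglyMeasurable u μ) :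
    ∫⁻ x, W x * ‖u x‖ₑ ^ 2 ∂μ ≤ eLpNorm u (ENNReal.ofReal (2 * p / (p - 1))) μ ^ 2 := by
  have h := lintegral_mul_enorm_sq_le (Real.HolderConjugate.conjExponent hp) hW hu
  rw [Real.conjExponent, ← mul_div_assoc] at h
  exact h.trans ((mul_le_mul_left hW1 _).trans_eq (one_mul _))

theorem tendsto_lintegral_optPot (hp : 1 < p) {g : α → ℝ} (hum : Measurable u) (hgm : Measurable g)
    (hu : MemLp u (ENNReal.ofReal (2 * p / (p - 1))) μ)
    (hg : MemLp g (ENNReal.ofReal (2 * p / (p - 1))) μ) (hc : 0 < c) {d t : ℕ → ℝ}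
    (hd : Tendsto d atTop (𝓝 c)) (ht : Tendsto t atTop (𝓝 0)) (ht0 : ∀ n, 0 ≤ t n)
    (ht1 : ∀ n, t n ≤ 1) :
    Tendsto (fun n => ∫⁻ x, ENNReal.ofReal
        (optPot p (d n) (fun x => (1 - t n) * u x + t n * g x) x) * ‖g x‖ₑ ^ 2 ∂μ) atTop
      (𝓝 (∫⁻ x, ENNReal.ofReal (optPot p c u x) * ‖g x‖ₑ ^ 2 ∂μ)) := by
  have hs : 0 ≤ 2 / (p - 1) := div_nonneg two_pos.le (by linarith)
  have hq : 0 < 2 * p / (p - 1) := by linarith [two_lt_dualExp hp]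
  have hdc : ∀ᶠ n in atTop, c / 2 < d n := hd.eventually_const_lt (by linarith)
  refine tendsto_lintegral_filter_of_dominated_convergence
    (fun x => ENNReal.ofReal (((c / 2) ^ (2 / (p - 1)))⁻¹ * (|u x| + |g x|) ^ (2 * p / (p - 1))))
    ?_ ?_ ?_ ?_
  · refine Eventually.of_forall fun n => Measurable.mul (Measurable.ennreal_ofReal ?_)
      (hgm.enorm.pow_const 2)
    exact measurable_optPot ((hum.const_mul _).add (hgm.const_mul _))
  · filter_upwards [hdc] with n hn
    refine Eventually.of_forall fun x => ?_
    have hdn : 0 < d n := by linarith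
    rw [← ofReal_norm, ← ENNReal.ofReal_pow (norm_nonneg _), Real.norm_eq_abs,
      ← ENNReal.ofReal_mul (optPot_nonneg hdn.le x)]
    refine ENNReal.ofReal_le_ofReal ?_
    have hA : |(1 - t n) * u x + t n * g x| ≤ |u x| + |g x| := by
      refine (abs_add_le _ _).trans ?_
      rw [abs_mul, abs_mul, abs_of_nonneg (ht0 n), abs_of_nonneg (by linarith [ht1 n])]
      exact add_le_add (mul_le_of_le_one_left (abs_nonneg _) (by linarith [ht0 n]))
        (mul_le_of_le_one_left (abs_nonneg _) (ht1 n))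
    have h2 : 2 * p / (p - 1) = 2 / (p - 1) + 2 := by
      have : p - 1 ≠ 0 := by linarith
      field_simp; ring
    rw [h2, Real.rpow_add_of_nonneg (by positivity) hs two_pos.le, Real.rpow_two, ← mul_assoc,
      ← div_eq_inv_mul, ← Real.div_rpow (by positivity) (by positivity), optPot]
    gcongr
    linarith [abs_nonneg (u x)]
  · have hs : MemLp (fun x => |u x| + |g x|) (ENNReal.ofReal (2 * p / (p - 1))) μ :=
      hu.norm.add hg.norm
    have h1 := lintegral_rpow_enorm_lt_top_of_eLpNorm_lt_top (by simpa using hq)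
      ENNReal.ofReal_ne_top hs.2
    rw [ENNReal.toReal_ofReal hq.le] at h1
    have h3 : ∀ x, ENNReal.ofReal (((c / 2) ^ (2 / (p - 1)))⁻¹ *
        (|u x| + |g x|) ^ (2 * p / (p - 1))) = ENNReal.ofReal (((c / 2) ^ (2 / (p - 1)))⁻¹) *
        ‖|u x| + |g x|‖ₑ ^ (2 * p / (p - 1)) := fun x => by
      rw [ENNReal.ofReal_mul (by positivity), ← ofReal_norm, Real.norm_of_nonneg (by positivity),
        ENNReal.ofReal_rpow_of_nonneg (by positivity) hq.le]
    simp_rw [h3]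
    rw [lintegral_const_mul' _ _ ENNReal.ofReal_ne_top]
    exact (ENNReal.mul_lt_top ENNReal.ofReal_lt_top h1).ne
  · refine Eventually.of_forall fun x => ?_
    refine ENNReal.Tendsto.mul_const ?_ (Or.inr (by finiteness))
    refine ENNReal.tendsto_ofReal ?_
    have h1 : Tendsto (fun n => (1 - t n) * u x + t n * g x) atTop (𝓝 (u x)) := by
      have := ((ht.const_sub 1).mul_const (u x)).add (ht.mul_const (g x))
      simpa using this
    exact (h1.abs.div hd hc.ne').rpow_const (Or.inr hs)

end OptimalPotential

variable {N : ℕ} [hN : Fact (3 ≤ N)] {Ω : Set (Eucl N)} {f : W012 Ω →ₗ[ℝ] ℝ} {p : ℝ}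

theorem measurable_fnOf (u : W012 Ω) : Measurable (fnOf u) :=
  (Lp.stronglyMeasurable (fnOf u)).measurable

/-- The minimiser of `G_{p,f}` is a minimiser for its own optimal potential, among the functions
in `L^{2p/(p-1)}`. -/
theorem realG_le_of_dualNorm_lt_top (hp : 1 < p) {v : W012 Ω} (hv : IsMinimizerG p f v)
    (hv0 : 0 < dualNorm p v) {w : W012 Ω} (hw : dualNorm p w < ⊤) :
    realG p f v ≤ quadPart f w + 1 / 2 * (∫⁻ x, ENNReal.ofReal
      (optPot p (dualNorm p v).toReal (fnOf v) x) * ‖fnOf w x‖ₑ ^ 2 ∂(vol Ω)).toReal := by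
  have hvfin := dualNorm_lt_top_of_isMinimizerG hv
  have hc : 0 < (dualNorm p v).toReal := ENNReal.toReal_pos hv0.ne' hvfin.ne
  set c := (dualNorm p v).toReal with hcdef
  let t : ℕ → ℝ := fun n => 1 / ((n : ℝ) + 1)
  have ht : Tendsto t atTop (𝓝 0) := tendsto_one_div_add_atTop_nhds_zero_nat
  have ht0 : ∀ n, 0 < t n := fun n => by simp only [t]; positivity
  have ht1 : ∀ n, t n ≤ 1 := fun n => by
    simp only [t]; rw [div_le_one (by positivity)]; linarith [(Nat.cast_nonneg n : (0 : ℝ) ≤ n)]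
  let z : ℕ → W012 Ω := fun n => (1 - t n) • v + t n • w
  have hzfin : ∀ n, dualNorm p (z n) < ⊤ := fun n => dualNorm_combination_lt_top hp _ _ hvfin hw
  have hzle : ∀ n, (dualNorm p (z n)).toReal ≤ (1 - t n) * c + t n * (dualNorm p w).toReal :=
    fun n => by
      have := toReal_dualNorm_combination_le hp (1 - t n) (t n) hvfin hw
      rwa [abs_of_nonneg (by linarith [ht1 n]), abs_of_nonneg (ht0 n).le] at this
  have hzge : ∀ n, c - 2 * t n * (c + (dualNorm p w).toReal) ≤ (dualNorm p (z n)).toReal :=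
    fun n => by
      have e : v = (1 : ℝ) • z n + (t n) • ((1 : ℝ) • v + (-1 : ℝ) • w) := by
        simp only [z]; module
      have h1 := toReal_dualNorm_combination_le hp 1 (-1) hvfin hw
      have h2 := toReal_dualNorm_combination_le hp 1 (t n) (hzfin n)
        (dualNorm_combination_lt_top hp 1 (-1) hvfin hw)
      rw [← e, ← hcdef, abs_one, abs_of_pos (ht0 n), one_mul] at h2
      rw [abs_one, abs_neg, abs_one, one_mul, one_mul, ← hcdef] at h1
      have h3 := mul_le_mul_of_nonneg_left h1 (ht0 n).le
      have h4 : 0 ≤ t n * (c + (dualNorm p w).toReal) :=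
        mul_nonneg (ht0 n).le (by positivity)
      linarith
  have hd : Tendsto (fun n => (dualNorm p (z n)).toReal) atTop (𝓝 c) := by
    refine tendsto_of_tendsto_of_tendsto_of_le_of_le ?_ ?_ hzge hzle
    · have := ((ht.const_mul 2).mul_const (c + (dualNorm p w).toReal)).const_sub c
      simpa using this
    · have := ((ht.const_sub 1).mul_const c).add (ht.mul_const (dualNorm p w).toReal)
      simpa using this
  have hmem : ∀ {y : W012 Ω}, dualNorm p y < ⊤ →
      MemLp (fnOf y) (ENNReal.ofReal (2 * p / (p - 1))) (vol Ω) := fun {y} hy =>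
    ⟨Lp.aestronglyMeasurable _, hy⟩
  have hlim := tendsto_lintegral_optPot hp (measurable_fnOf v) (measurable_fnOf w) (hmem hvfin)
    (hmem hw) hc hd ht (fun n => (ht0 n).le) ht1
  have hball : ∀ {y y' : W012 Ω} {d : ℝ}, d = (dualNorm p y).toReal → 0 < d →
      ∫⁻ x, ENNReal.ofReal (optPot p d (fnOf y) x) * ‖fnOf y' x‖ₑ ^ 2 ∂(vol Ω) ≤
        dualNorm p y' ^ 2 := fun {y y' d} hd hd0 =>
    lintegral_ball_mul_sq_le hp (measurable_optPot (measurable_fnOf y)).ennreal_ofReal.aemeasurable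
      (eLpNorm_optPot hp hd hd0).le (Lp.aestronglyMeasurable _)
  have hKfin : ∫⁻ x, ENNReal.ofReal (optPot p c (fnOf v) x) * ‖fnOf w x‖ₑ ^ 2 ∂(vol Ω) ≠ ⊤ :=
    ((hball hcdef hc).trans_lt (ENNReal.pow_lt_top hw)).ne
  have hlim' := ((ENNReal.tendsto_toReal hKfin).comp hlim).const_mul (1 / 2)
  refine ge_of_tendsto (hlim'.const_add (quadPart f w)) ?_
  filter_upwards [hd.eventually_const_lt hc] with n hdn
  set d := (dualNorm p (z n)).toReal with hddef
  have hz := fnOf_combination (1 - t n) (t n) v w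
  have hcongr : ∀ y : W012 Ω, ∫⁻ x, ENNReal.ofReal
      (optPot p d (fun x => (1 - t n) * fnOf v x + t n * fnOf w x) x) * ‖fnOf y x‖ₑ ^ 2 ∂(vol Ω) =
      ∫⁻ x, ENNReal.ofReal (optPot p d (fnOf (z n)) x) * ‖fnOf y x‖ₑ ^ 2 ∂(vol Ω) := fun y => by
    refine lintegral_congr_ae ?_
    filter_upwards [hz] with x hx
    simp only [optPot, z, hx]
  simp only [Function.comp]
  rw [hcongr]
  set K : W012 Ω → ℝ≥0∞ := fun y =>
    ∫⁻ x, ENNReal.ofReal (optPot p d (fnOf (z n)) x) * ‖fnOf y x‖ₑ ^ 2 ∂(vol Ω) with hK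
  have hKf : ∀ {y : W012 Ω}, dualNorm p y < ⊤ → K y ≠ ⊤ := fun hy =>
    ((hball hddef hdn).trans_lt (ENNReal.pow_lt_top hy)).ne
  have hKz : K (z n) = ENNReal.ofReal (d ^ 2) := lintegral_optPot_mul_self hp hddef hdn
  have hKv : (K v).toReal ≤ c ^ 2 := by
    rw [hcdef, ← ENNReal.toReal_pow]
    exact ENNReal.toReal_mono (ENNReal.pow_ne_top hvfin.ne) (hball hddef hdn)
  have hconv : K (z n) ≤ ENNReal.ofReal (1 - t n) * K v + ENNReal.ofReal (t n) * K w := by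
    have hmeas : ∀ y : W012 Ω, Measurable fun x =>
        ENNReal.ofReal (optPot p d (fnOf (z n)) x) * ‖fnOf y x‖ₑ ^ 2 := fun y =>
      (measurable_optPot (measurable_fnOf _)).ennreal_ofReal.mul
        ((measurable_fnOf y).enorm.pow_const 2)
    simp only [hK]
    rw [← lintegral_const_mul _ (hmeas v), ← lintegral_const_mul _ (hmeas w),
      ← lintegral_add_left ((hmeas v).const_mul _)]
    refine lintegral_mono_ae ?_
    filter_upwards [hz] with x hx
    have hx' : fnOf (z n) x = (1 - t n) * fnOf v x + t n * fnOf w x := hx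
    have hsq : ‖fnOf (z n) x‖ₑ ^ 2 ≤ ENNReal.ofReal (1 - t n) * ‖fnOf v x‖ₑ ^ 2 +
        ENNReal.ofReal (t n) * ‖fnOf w x‖ₑ ^ 2 := by
      have hcv : 0 ≤ 1 - t n := by linarith [ht1 n]
      rw [hx', ← ofReal_norm, ← ofReal_norm, ← ofReal_norm, ← ENNReal.ofReal_pow (norm_nonneg _),
        ← ENNReal.ofReal_pow (norm_nonneg _), ← ENNReal.ofReal_pow (norm_nonneg _),
        ← ENNReal.ofReal_mul hcv, ← ENNReal.ofReal_mul (ht0 n).le,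
        ← ENNReal.ofReal_add (by positivity) (mul_nonneg (ht0 n).le (by positivity))]
      refine ENNReal.ofReal_le_ofReal ?_
      simp only [Real.norm_eq_abs, sq_abs]
      nlinarith [mul_nonneg (mul_nonneg (ht0 n).le hcv) (sq_nonneg (fnOf v x - fnOf w x))]
    refine (mul_le_mul_right hsq _).trans_eq ?_
    ring
  have hconv' : d ^ 2 ≤ (1 - t n) * (K v).toReal + t n * (K w).toReal := by
    have h1 : 0 ≤ 1 - t n := by linarith [ht1 n]
    rw [hKz, ← ENNReal.ofReal_toReal (hKf hvfin), ← ENNReal.ofReal_toReal (hKf hw),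
      ← ENNReal.ofReal_mul h1, ← ENNReal.ofReal_mul (ht0 n).le,
      ← ENNReal.ofReal_add (mul_nonneg h1 ENNReal.toReal_nonneg)
        (mul_nonneg (ht0 n).le ENNReal.toReal_nonneg), ENNReal.ofReal_le_ofReal_iff (by positivity)]
      at hconv
    exact hconv
  have hmin := (isMinimizerG_iff hvfin).1 hv (z n) (hzfin n)
  have e1 : realG p f (z n) = quadPart f (z n) + 1 / 2 * d ^ 2 := rfl
  have e2 : realG p f v = quadPart f v + 1 / 2 * c ^ 2 := rfl
  have e3 : quadPart f (z n) ≤ (1 - t n) * quadPart f v + t n * quadPart f w := by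
    have := quadPart_combination f (t n) v w
    have h2 : 0 ≤ t n * (1 - t n) / 2 * ‖gradOf v - gradOf w‖ ^ 2 :=
      mul_nonneg (div_nonneg (mul_nonneg (ht0 n).le (by linarith [ht1 n])) two_pos.le) (sq_nonneg _)
    simp only [z]
    linarith
  have e4 : (1 - t n) * (K v).toReal ≤ (1 - t n) * c ^ 2 :=
    mul_le_mul_of_nonneg_left hKv (by linarith [ht1 n])
  have e5 : t n * realG p f v ≤ t n * (quadPart f w + 1 / 2 * (K w).toReal) := by
    rw [e1] at hmin
    have e6 : realG p f v = (1 - t n) * realG p f v + t n * realG p f v := by ring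
    have e7 : (1 - t n) * realG p f v = (1 - t n) * quadPart f v + 1 / 2 * ((1 - t n) * c ^ 2) := by
      rw [e2]; ring
    linarith
  exact le_of_mul_le_mul_left e5 (ht0 n)

/-- The minimiser of `G_{p,f}` is a minimiser for its own optimal potential. -/
theorem realG_le (hΩ : IsOpen Ω) (hp : 1 < p) (hf : MemDual f) {v : W012 Ω}
    (hv : IsMinimizerG p f v) (hv0 : 0 < dualNorm p v) (u : W012 Ω)
    (hu : ∫⁻ x, ENNReal.ofReal (optPot p (dualNorm p v).toReal (fnOf v) x) *
      ‖fnOf u x‖ₑ ^ 2 ∂(vol Ω) ≠ ⊤) :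
    realG p f v ≤ quadPart f u + 1 / 2 * (∫⁻ x, ENNReal.ofReal
      (optPot p (dualNorm p v).toReal (fnOf v) x) * ‖fnOf u x‖ₑ ^ 2 ∂(vol Ω)).toReal := by
  obtain ⟨w, L, hw, hgrad, hle, hae⟩ := exists_truncation hΩ u
  set W : Eucl N → ℝ≥0∞ := fun x =>
    ENNReal.ofReal (optPot p (dualNorm p v).toReal (fnOf v) x) with hW
  have hWm : Measurable W := (measurable_optPot (measurable_fnOf v)).ennreal_ofReal
  have hlim : Tendsto (fun n => ∫⁻ x, W x * ‖fnOf (w n) x‖ₑ ^ 2 ∂(vol Ω)) atTop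
      (𝓝 (∫⁻ x, W x * ‖fnOf u x‖ₑ ^ 2 ∂(vol Ω))) := by
    refine tendsto_lintegral_of_dominated_convergence
      (fun x => ENNReal.ofReal (L ^ 2) * (W x * ‖fnOf u x‖ₑ ^ 2))
      (fun n => hWm.mul ((measurable_fnOf _).enorm.pow_const 2)) (fun n => ?_) ?_ ?_
    · filter_upwards [hle n] with x hx
      rw [mul_left_comm]
      gcongr
      rw [← ofReal_norm, ← ofReal_norm, ← ENNReal.ofReal_pow (norm_nonneg _),
        ← ENNReal.ofReal_pow (norm_nonneg _), ← ENNReal.ofReal_mul (sq_nonneg _), ← mul_pow]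
      exact ENNReal.ofReal_le_ofReal (pow_le_pow_left₀ (norm_nonneg _) hx 2)
    · rw [lintegral_const_mul' _ _ ENNReal.ofReal_ne_top]
      exact ENNReal.mul_ne_top ENNReal.ofReal_ne_top hu
    · filter_upwards [hae] with x hx
      refine ENNReal.Tendsto.const_mul ?_ (Or.inr (by simp [hW]))
      exact ((ENNReal.continuous_pow 2).tendsto _).comp hx.enorm
  refine ge_of_tendsto' ((tendsto_quadPart hf hgrad).add
    (((ENNReal.tendsto_toReal hu).comp hlim).const_mul (1 / 2))) fun n => ?_
  exact realG_le_of_dualNorm_lt_top hp hv hv0 (hw n _ (by linarith [two_lt_dualExp hp]))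

end

section

section Potentials

variable {N : ℕ}

theorem abs_eq_posPot_add_negPot (V : Eucl N → EReal) (x : Eucl N) :
    (V x).abs = posPot V x + negPot V x := by
  unfold posPot negPot
  induction V x with
  | bot => simp
  | top => simp
  | coe r =>
    rw [EReal.abs_def, ← EReal.coe_neg, EReal.toENNReal_of_ne_top (EReal.coe_ne_top _),
      EReal.toENNReal_of_ne_top (EReal.coe_ne_top _), EReal.toReal_coe, EReal.toReal_coe]
    rcases le_total 0 r with h | h
    · rw [abs_of_nonneg h, ENNReal.ofReal_of_nonpos (neg_nonpos.2 h), add_zero]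
    · rw [abs_of_nonpos h, ENNReal.ofReal_of_nonpos h, zero_add]

theorem measurable_posPot {V : Eucl N → EReal} (hV : Measurable V) : Measurable (posPot V) :=
  hV.ereal_toENNReal

theorem measurable_negPot {V : Eucl N → EReal} (hV : Measurable V) : Measurable (negPot V) :=
  hV.neg.ereal_toENNReal

theorem measurable_abs {V : Eucl N → EReal} (hV : Measurable V) :
    Measurable fun x => (V x).abs := by
  simp_rw [abs_eq_posPot_add_negPot]
  exact (measurable_posPot hV).add (measurable_negPot hV)

variable {Ω : Set (Eucl N)} {p : ℝ} {V : Eucl N → EReal}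

theorem ae_coe_toReal_eq (hp : 1 < p) (hV : Measurable V) (hpot : potNorm Ω p V ≤ 1) :
    ∀ᵐ x ∂(vol Ω), ((V x).toReal : EReal) = V x := by
  have hp0 : 0 < p := by linarith
  have h := lintegral_rpow_enorm_lt_top_of_eLpNorm_lt_top (by simpa using hp0)
    ENNReal.ofReal_ne_top (hpot.trans_lt ENNReal.one_lt_top)
  filter_upwards [ae_lt_top ((measurable_abs hV).pow_const _) h.ne] with x hx
  rw [ENNReal.toReal_ofReal hp0.le] at hx
  refine EReal.coe_toReal ?_ ?_ <;>
  · intro h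
    rw [h] at hx
    simp [ENNReal.top_rpow_of_pos hp0] at hx

theorem enorm_toReal_eq_abs {x : EReal} (hx : (x.toReal : EReal) = x) : ‖x.toReal‖ₑ = x.abs := by
  conv_rhs => rw [← hx, EReal.abs_def]
  rw [← ofReal_norm, Real.norm_eq_abs]

theorem eLpNorm_toReal_eq_potNorm (hp : 1 < p) (hV : Measurable V) (hpot : potNorm Ω p V ≤ 1) :
    eLpNorm (fun x => (V x).toReal) (ENNReal.ofReal p) (vol Ω) = potNorm Ω p V := by
  refine eLpNorm_congr_enorm_ae ?_
  filter_upwards [ae_coe_toReal_eq hp hV hpot] with x hx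
  rw [enorm_toReal_eq_abs hx, enorm_eq_self]

theorem memLp_toReal (hp : 1 < p) (hV : Measurable V) (hpot : potNorm Ω p V ≤ 1) :
    MemLp (fun x => (V x).toReal) (ENNReal.ofReal p) (vol Ω) :=
  ⟨hV.ereal_toReal.aestronglyMeasurable, by
    rw [eLpNorm_toReal_eq_potNorm hp hV hpot]; exact hpot.trans_lt ENNReal.one_lt_top⟩

theorem eLpNorm_posPot_le : eLpNorm (posPot V) (ENNReal.ofReal p) (vol Ω) ≤ potNorm Ω p V :=
  eLpNorm_mono_enorm fun x => by
    rw [enorm_eq_self, enorm_eq_self, abs_eq_posPot_add_negPot]; exact le_self_add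

theorem eLpNorm_negPot_le : eLpNorm (negPot V) (ENNReal.ofReal p) (vol Ω) ≤ potNorm Ω p V :=
  eLpNorm_mono_enorm fun x => by
    rw [enorm_eq_self, enorm_eq_self, abs_eq_posPot_add_negPot]; exact le_add_self

end Potentials

variable {N : ℕ} [hN : Fact (3 ≤ N)] {Ω : Set (Eucl N)} {f : W012 Ω →ₗ[ℝ] ℝ} {p : ℝ}
  {V : Eucl N → EReal}

theorem energyFunctional_eq_coe {u : W012 Ω}
    (hP : ∫⁻ x, posPot V x * ‖fnOf u x‖ₑ ^ 2 ∂(vol Ω) ≠ ⊤)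
    (hM : ∫⁻ x, negPot V x * ‖fnOf u x‖ₑ ^ 2 ∂(vol Ω) ≠ ⊤) :
    energyFunctional f V u = ((quadPart f u
      + 1 / 2 * (∫⁻ x, posPot V x * ‖fnOf u x‖ₑ ^ 2 ∂(vol Ω)).toReal
      - 1 / 2 * (∫⁻ x, negPot V x * ‖fnOf u x‖ₑ ^ 2 ∂(vol Ω)).toReal : ℝ) : EReal) := by
  rw [energyFunctional, ← EReal.coe_ennreal_toReal (ENNReal.mul_ne_top (by simp) hP),
    ← EReal.coe_ennreal_toReal (ENNReal.mul_ne_top (by simp) hM), ENNReal.toReal_mul,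
    ENNReal.toReal_mul, ← EReal.coe_add, ← EReal.coe_sub]
  congr 1
  simp [quadPart]

theorem lintegral_negPot_mul_sq_le (hV : Measurable V) (u : W012 Ω) :
    ∫⁻ x, negPot V x * ‖fnOf u x‖ₑ ^ 2 ∂(vol Ω) ≤
      eLpNorm (negPot V) ((N : ℝ≥0∞) / 2) (vol Ω) * ENNReal.ofReal (‖fnOf u‖ ^ 2) := by
  have h3 := three_le_cast N
  have hconj : ((N : ℝ) / 2).HolderConjugate ((N : ℝ) / (N - 2)) := by
    rw [Real.holderConjugate_iff]
    have : (N : ℝ) ≠ 0 := by linarith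
    refine ⟨by linarith, ?_⟩
    rw [inv_div, inv_div]; field_simp; ring
  have h := lintegral_mul_enorm_sq_le hconj (measurable_negPot hV).aemeasurable
    (Lp.aestronglyMeasurable (fnOf u))
  have e1 : ENNReal.ofReal ((N : ℝ) / 2) = (N : ℝ≥0∞) / 2 := by
    rw [ENNReal.ofReal_div_of_pos two_pos]; simp
  have e2 : ENNReal.ofReal (2 * ((N : ℝ) / (N - 2))) = sobolevExp N := by
    rw [← mul_div_assoc]; rfl
  have e3 : eLpNorm (fnOf u) (sobolevExp N) (vol Ω) = ENNReal.ofReal ‖fnOf u‖ := by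
    rw [Lp.norm_def, ENNReal.ofReal_toReal (Lp.eLpNorm_ne_top _)]
  rw [e1, e2, e3, ← ENNReal.ofReal_pow (norm_nonneg _)] at h
  exact h

/-- The energy of an admissible potential is bounded below. -/
theorem exists_le_energyFunctional (hf : MemDual f) (hV : Admissible Ω V) :
    ∃ B : ℝ, ∀ u : W012 Ω, (B : EReal) ≤ energyFunctional f V u := by
  obtain ⟨hVm, -, hVN⟩ := hV
  obtain ⟨t, ht0, hkt, htT⟩ := ENNReal.lt_iff_exists_real_btwn.1 hVN
  set k := eLpNorm (negPot V) ((N : ℝ≥0∞) / 2) (vol Ω) with hk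
  have hkfin : k ≠ ⊤ := hkt.ne_top
  have hkt' : k.toReal < t := by
    rwa [ENNReal.lt_ofReal_iff_toReal_lt hkfin] at hkt
  have htpos : 0 < t := ENNReal.toReal_nonneg.trans_lt hkt'
  obtain ⟨B, hB⟩ := coercive_bound hf (κ := 1 - k.toReal / t)
    (by rw [sub_pos, div_lt_one htpos]; exact hkt')
  refine ⟨B, fun u => ?_⟩
  have hM := lintegral_negPot_mul_sq_le hVm u
  have hMfin : ∫⁻ x, negPot V x * ‖fnOf u x‖ₑ ^ 2 ∂(vol Ω) ≠ ⊤ :=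
    ne_top_of_le_ne_top (ENNReal.mul_ne_top hkfin ENNReal.ofReal_ne_top) hM
  have hM' := ENNReal.toReal_mono (ENNReal.mul_ne_top hkfin ENNReal.ofReal_ne_top) hM
  rw [ENNReal.toReal_mul, ENNReal.toReal_ofReal (sq_nonneg _)] at hM'
  have hS := sq_norm_le_of_le_sobolevConst htT.le u
  have h1 : k.toReal * ‖fnOf u‖ ^ 2 ≤ k.toReal / t * ‖gradOf u‖ ^ 2 := by
    rw [div_mul_eq_mul_div, le_div_iff₀ htpos, mul_assoc, mul_comm (‖fnOf u‖ ^ 2)]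
    exact mul_le_mul_of_nonneg_left hS ENNReal.toReal_nonneg
  have h2 := hB u
  set M := ∫⁻ x, negPot V x * ‖fnOf u x‖ₑ ^ 2 ∂(vol Ω) with hMdef
  have h3 : B ≤ quadPart f u - 1 / 2 * M.toReal := by
    rw [quadPart]; linarith
  rw [energyFunctional, ← hMdef, ← EReal.coe_ennreal_toReal (x := 2⁻¹ * M)
    (ENNReal.mul_ne_top (by simp) hMfin), ENNReal.toReal_mul]
  have h4 : (B : EReal) ≤ ((quadPart f u : ℝ) : EReal) - ((1 / 2 * M.toReal : ℝ) : EReal) := by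
    rw [← EReal.coe_sub]; exact EReal.coe_le_coe_iff.2 h3
  refine h4.trans ?_
  refine EReal.sub_le_sub ?_ (le_of_eq (by simp))
  exact le_add_of_nonneg_right (EReal.coe_ennreal_nonneg _)

/-- Both parts of the potential energy of `u` are finite for a potential in the ball of `L^p`. -/
theorem lintegral_posPot_mul_sq_le (hp : 1 < p) (hV : Measurable V) (hpot : potNorm Ω p V ≤ 1)
    (u : W012 Ω) : ∫⁻ x, posPot V x * ‖fnOf u x‖ₑ ^ 2 ∂(vol Ω) ≤ dualNorm p u ^ 2 :=
  lintegral_ball_mul_sq_le hp (measurable_posPot hV).aemeasurable (eLpNorm_posPot_le.trans hpot)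
    (Lp.aestronglyMeasurable _)

theorem lintegral_negPot_mul_sq_le_dualNorm (hp : 1 < p) (hV : Measurable V)
    (hpot : potNorm Ω p V ≤ 1) (u : W012 Ω) :
    ∫⁻ x, negPot V x * ‖fnOf u x‖ₑ ^ 2 ∂(vol Ω) ≤ dualNorm p u ^ 2 :=
  lintegral_ball_mul_sq_le hp (measurable_negPot hV).aemeasurable (eLpNorm_negPot_le.trans hpot)
    (Lp.aestronglyMeasurable _)

theorem integrable_toReal_mul_sq (hp : 1 < p) (hV : Measurable V) (hpot : potNorm Ω p V ≤ 1)
    {u : W012 Ω} (hu : dualNorm p u < ⊤) :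
    Integrable (fun x => (V x).toReal * fnOf u x ^ 2) (vol Ω) := by
  refine ⟨(hV.ereal_toReal.mul ((measurable_fnOf u).pow_const 2)).aestronglyMeasurable, ?_⟩
  rw [hasFiniteIntegral_iff_enorm]
  refine lt_of_le_of_lt ?_ (ENNReal.pow_lt_top hu (n := 2))
  refine le_trans (lintegral_mono_ae ?_) (lintegral_ball_mul_sq_le hp
    (measurable_abs hV).aemeasurable hpot (Lp.aestronglyMeasurable (fnOf u)))
  filter_upwards [ae_coe_toReal_eq hp hV hpot] with x hx
  rw [enorm_mul, enorm_toReal_eq_abs hx, enorm_pow]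

theorem energyFunctional_eq_integral (hp : 1 < p) (hV : Measurable V) (hpot : potNorm Ω p V ≤ 1)
    {u : W012 Ω} (hu : dualNorm p u < ⊤) :
    energyFunctional f V u =
      ((quadPart f u + 1 / 2 * ∫ x, (V x).toReal * fnOf u x ^ 2 ∂(vol Ω) : ℝ) : EReal) := by
  have hfin : dualNorm p u ^ 2 ≠ ⊤ := (ENNReal.pow_lt_top hu).ne
  rw [energyFunctional_eq_coe (ne_top_of_le_ne_top hfin (lintegral_posPot_mul_sq_le hp hV hpot u))
    (ne_top_of_le_ne_top hfin (lintegral_negPot_mul_sq_le_dualNorm hp hV hpot u)),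
    integral_eq_lintegral_pos_part_sub_lintegral_neg_part (integrable_toReal_mul_sq hp hV hpot hu)]
  have hsq : ∀ x, ENNReal.ofReal (fnOf u x ^ 2) = ‖fnOf u x‖ₑ ^ 2 := fun x => by
    rw [← ofReal_norm, ← ENNReal.ofReal_pow (norm_nonneg _), Real.norm_eq_abs, sq_abs]
  have hae := ae_coe_toReal_eq hp hV hpot
  have e1 : ∫⁻ x, posPot V x * ‖fnOf u x‖ₑ ^ 2 ∂(vol Ω) =
      ∫⁻ x, ENNReal.ofReal ((V x).toReal * fnOf u x ^ 2) ∂(vol Ω) := by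
    refine lintegral_congr_ae ?_
    filter_upwards [hae] with x hx
    rw [ENNReal.ofReal_mul' (sq_nonneg _), hsq, posPot,
      EReal.toENNReal_of_ne_top (by rw [← hx]; exact EReal.coe_ne_top _)]
  have e2 : ∫⁻ x, negPot V x * ‖fnOf u x‖ₑ ^ 2 ∂(vol Ω) =
      ∫⁻ x, ENNReal.ofReal (-((V x).toReal * fnOf u x ^ 2)) ∂(vol Ω) := by
    refine lintegral_congr_ae ?_
    filter_upwards [hae] with x hx
    rw [← neg_mul, ENNReal.ofReal_mul' (sq_nonneg _), hsq, negPot]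
    conv_lhs => rw [← hx, ← EReal.coe_neg, EReal.toENNReal_of_ne_top (EReal.coe_ne_top _),
      EReal.toReal_coe]
  rw [e1, e2]
  congr 1
  ring

theorem energy_ne_bot_and_ne_top (hp : 1 < p) (hf : MemDual f) (hV : Admissible Ω V)
    (hpot : potNorm Ω p V ≤ 1) : energy f V ≠ ⊥ ∧ energy f V ≠ ⊤ := by
  constructor
  · obtain ⟨B, hB⟩ := exists_le_energyFunctional hf hV
    exact ne_bot_of_le_ne_bot (EReal.coe_ne_bot B) (le_iInf hB)
  · refine ne_top_of_le_ne_top ?_ (iInf_le _ (0 : W012 Ω))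
    rw [energyFunctional_eq_integral hp hV.1 hpot (by rw [dualNorm_zero]; simp)]
    exact EReal.coe_ne_top _

/-- The optimal potential, built from the minimiser of `G_{p,f}`. -/
def maximalPot (p : ℝ) (v : W012 Ω) (x : Eucl N) : EReal :=
  (optPot p (dualNorm p v).toReal (fnOf v) x : ℝ)

variable {v : W012 Ω}

theorem posPot_maximalPot (x : Eucl N) :
    posPot (maximalPot p v) x = ENNReal.ofReal (optPot p (dualNorm p v).toReal (fnOf v) x) := by
  rw [posPot, maximalPot, EReal.toENNReal_of_ne_top (EReal.coe_ne_top _), EReal.toReal_coe]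

theorem negPot_maximalPot (x : Eucl N) : negPot (maximalPot p v) x = 0 := by
  rw [negPot, maximalPot, ← EReal.coe_neg, EReal.toENNReal_of_ne_top (EReal.coe_ne_top _),
    EReal.toReal_coe, ENNReal.ofReal_of_nonpos]
  exact neg_nonpos.2 (optPot_nonneg ENNReal.toReal_nonneg x)

theorem admissible_maximalPot : Admissible Ω (maximalPot p v) := by
  refine ⟨(measurable_optPot (measurable_fnOf v)).coe_real_ereal, fun x => EReal.coe_ne_bot _, ?_⟩
  have : negPot (maximalPot p v) = 0 := funext negPot_maximalPot
  rw [this, eLpNorm_zero]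
  exact sobolevConst_pos N

theorem potNorm_maximalPot (hp : 1 < p) (hv0 : 0 < dualNorm p v) (hv : dualNorm p v < ⊤) :
    potNorm Ω p (maximalPot p v) = 1 := by
  rw [← eLpNorm_optPot hp (c := (dualNorm p v).toReal) rfl (ENNReal.toReal_pos hv0.ne' hv.ne),
    potNorm]
  congr 1
  funext x
  rw [abs_eq_posPot_add_negPot, posPot_maximalPot, negPot_maximalPot, add_zero]

theorem energy_maximalPot (hΩ : IsOpen Ω) (hp : 1 < p) (hf : MemDual f)
    (hv : IsMinimizerG p f v) (hv0 : 0 < dualNorm p v) :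
    energy f (maximalPot p v) = (realG p f v : EReal) := by
  have hvfin := dualNorm_lt_top_of_isMinimizerG hv
  have hc : 0 < (dualNorm p v).toReal := ENNReal.toReal_pos hv0.ne' hvfin.ne
  refine le_antisymm ?_ (le_iInf fun u => ?_)
  · refine (iInf_le _ v).trans_eq ?_
    have hM : ∫⁻ x, negPot (maximalPot p v) x * ‖fnOf v x‖ₑ ^ 2 ∂(vol Ω) = 0 := by
      simp [negPot_maximalPot]
    have hP : ∫⁻ x, posPot (maximalPot p v) x * ‖fnOf v x‖ₑ ^ 2 ∂(vol Ω) =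
        ENNReal.ofReal ((dualNorm p v).toReal ^ 2) := by
      simp_rw [posPot_maximalPot]
      exact lintegral_optPot_mul_self hp rfl hc
    rw [energyFunctional_eq_coe (by rw [hP]; exact ENNReal.ofReal_ne_top) (by rw [hM]; simp), hP,
      hM, ENNReal.toReal_ofReal (sq_nonneg _), realG]
    simp
  · have hM : ∫⁻ x, negPot (maximalPot p v) x * ‖fnOf u x‖ₑ ^ 2 ∂(vol Ω) = 0 := by
      simp [negPot_maximalPot]
    rcases eq_or_ne (∫⁻ x, posPot (maximalPot p v) x * ‖fnOf u x‖ₑ ^ 2 ∂(vol Ω)) ⊤ with h | h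
    · rw [energyFunctional, h, hM, ENNReal.mul_top (by simp), EReal.coe_ennreal_top,
        EReal.coe_add_top, mul_zero, EReal.coe_ennreal_zero, sub_zero]
      exact le_top
    · rw [energyFunctional_eq_coe h (by rw [hM]; simp), hM, EReal.coe_le_coe_iff]
      simp_rw [posPot_maximalPot] at h ⊢
      have := realG_le hΩ hp hf hv hv0 u h
      simpa using this

/-- The energy gap controls the defect in Hölder's inequality. -/
theorem energy_gap (hΩ : IsOpen Ω) (hp : 1 < p) (hf : MemDual f) (hv : IsMinimizerG p f v)
    (hv0 : 0 < dualNorm p v) (hV : Admissible Ω V) (hpot : potNorm Ω p V ≤ 1) :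
    energy f V ≤ energy f (maximalPot p v) ∧
    ((ENNReal.ofReal (1 / 2 * ((dualNorm p v).toReal ^ 2
      - ∫ x, (V x).toReal * fnOf v x ^ 2 ∂(vol Ω))) : ℝ≥0∞) : EReal) ≤
      energy f (maximalPot p v) - energy f V := by
  have hvfin := dualNorm_lt_top_of_isMinimizerG hv
  obtain ⟨hbot, htop⟩ := energy_ne_bot_and_ne_top hp hf hV hpot
  have h1 : energy f V ≤ energyFunctional f V v := iInf_le _ v
  have hfin : dualNorm p v ^ 2 ≠ ⊤ := (ENNReal.pow_lt_top hvfin).ne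
  have hP := lintegral_posPot_mul_sq_le hp hV.1 hpot v
  have hM := lintegral_negPot_mul_sq_le_dualNorm hp hV.1 hpot v
  have hP' := ENNReal.toReal_mono hfin hP
  have e1 := energyFunctional_eq_integral (f := f) hp hV.1 hpot hvfin
  have e2 := energyFunctional_eq_coe (f := f) (V := V) (u := v) (ne_top_of_le_ne_top hfin hP)
    (ne_top_of_le_ne_top hfin hM)
  rw [energy_maximalPot hΩ hp hf hv hv0]
  obtain ⟨e, he⟩ : ∃ e : ℝ, (e : EReal) = energy f V := ⟨_, EReal.coe_toReal htop hbot⟩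
  rw [← he] at h1 ⊢
  rw [EReal.coe_le_coe_iff, ← EReal.coe_sub, EReal.coe_ennreal_ofReal, EReal.coe_le_coe_iff]
  have h2 := h1
  rw [e1, EReal.coe_le_coe_iff] at h1
  rw [e2, EReal.coe_le_coe_iff] at h2
  rw [ENNReal.toReal_pow] at hP'
  have hM0 : 0 ≤ (∫⁻ x, negPot V x * ‖fnOf v x‖ₑ ^ 2 ∂(vol Ω)).toReal := ENNReal.toReal_nonneg
  have h3 : e ≤ realG p f v := by rw [realG]; linarith
  refine ⟨h3, max_le ?_ (by linarith)⟩
  rw [realG]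
  linarith

end

section

/-- The constant of the quantitative Hölder inequality in `L^r`, scaled by `c ^ 2 / 2`. -/
def stabConst (r c : ℝ) : ℝ := 1 / 2 * c ^ 2 * ((r - 1) / 2 * 2 ^ (r - 2))

theorem stabConst_pos {r c : ℝ} (hr : 1 < r) (hc : 0 < c) : 0 < stabConst r c := by
  have : 0 < r - 1 := by linarith
  unfold stabConst; positivity

theorem one_lt_conj {p : ℝ} (hp : 1 < p) : 1 < p / (p - 1) := by
  rw [lt_div_iff₀ (by linarith)]; linarith

/-- The signed power `|t|^(p-2) t` and its inverse. -/
theorem signed_rpow_conj {p : ℝ} (hp : 1 < p) (t : ℝ) :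
    |(|t| ^ (p - 2) * t)| ^ (p / (p - 1) - 2) * (|t| ^ (p - 2) * t) = t := by
  rcases eq_or_ne t 0 with rfl | ht
  · simp
  · have h0 : 0 < |t| := abs_pos.2 ht
    have h1 : p - 1 ≠ 0 := by linarith
    have e : (p - 2 + 1) * (p / (p - 1) - 2) + (p - 2) = 0 := by field_simp; ring
    rw [abs_mul, abs_of_nonneg (Real.rpow_nonneg (abs_nonneg t) _), ← Real.rpow_add_one h0.ne',
      ← Real.rpow_mul h0.le, ← mul_assoc, ← Real.rpow_add h0, e, Real.rpow_zero, one_mul]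

theorem rpow_sub_two_mul_self {p t : ℝ} (hp : 1 < p) (ht : 0 ≤ t) :
    |t| ^ (p - 2) * t = t ^ (p - 1) := by
  rw [abs_of_nonneg ht]
  rcases ht.eq_or_lt with rfl | ht
  · simp [Real.zero_rpow (by linarith : p - 1 ≠ 0)]
  · rw [← Real.rpow_add_one ht.ne']; ring_nf

theorem abs_signed_rpow {p : ℝ} (hp : 1 < p) (t : ℝ) : |(|t| ^ (p - 2) * t)| = |t| ^ (p - 1) := by
  rw [abs_mul, abs_of_nonneg (Real.rpow_nonneg (abs_nonneg t) _)]
  have := rpow_sub_two_mul_self hp (abs_nonneg t)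
  rwa [abs_abs] at this

theorem eLpNorm_conj_of_abs_eq {α : Type*} {m : MeasurableSpace α} {μ : Measure α} {p : ℝ}
    (hp : 1 < p) {g a : α → ℝ} (h : ∀ x, |a x| = |g x| ^ (p - 1)) :
    eLpNorm a (ENNReal.ofReal (p / (p - 1))) μ = eLpNorm g (ENNReal.ofReal p) μ ^ (p - 1) := by
  have h1 : 0 < p - 1 := by linarith
  have e : ENNReal.ofReal (p / (p - 1)) * ENNReal.ofReal (p - 1) = ENNReal.ofReal p := by
    rw [← ENNReal.ofReal_mul (by positivity), div_mul_cancel₀ _ h1.ne']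
  rw [← e, ← eLpNorm_norm_rpow g h1]
  refine eLpNorm_congr_norm_ae (Eventually.of_forall fun x => ?_)
  simp only [Real.norm_eq_abs]
  rw [h, abs_of_nonneg (Real.rpow_nonneg (abs_nonneg _) _)]

variable {N : ℕ} [hN : Fact (3 ≤ N)] {Ω : Set (Eucl N)} {f : W012 Ω →ₗ[ℝ] ℝ} {p : ℝ}
  {V : Eucl N → EReal} {v : W012 Ω}

theorem toReal_maximalPot (x : Eucl N) :
    (maximalPot p v x).toReal = optPot p (dualNorm p v).toReal (fnOf v) x := EReal.toReal_coe _

theorem toReal_maximalPot_rpow (hp : 1 < p) (x : Eucl N) :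
    (maximalPot p v x).toReal ^ (p - 1) = (|fnOf v x| / (dualNorm p v).toReal) ^ 2 := by
  rw [toReal_maximalPot, optPot, ← Real.rpow_mul (by positivity),
    div_mul_cancel₀ _ (by linarith : p - 1 ≠ 0), Real.rpow_two]

/-- A quantitative Hölder bound turns into a stability estimate for the energy. -/
theorem stability_of_bound (hΩ : IsOpen Ω) (hp : 1 < p) (hf : MemDual f)
    (hv : IsMinimizerG p f v) (hv0 : 0 < dualNorm p v) (hV : Admissible Ω V)
    (hpot : potNorm Ω p V ≤ 1) {κ : ℝ} {X : ℝ≥0∞} {g : Eucl N → ℝ}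
    (hg : ∀ x, g x = (V x).toReal * (maximalPot p v x).toReal ^ (p - 1))
    (hX : Integrable g (vol Ω) →
      ENNReal.ofReal κ * X ^ 2 ≤ ENNReal.ofReal (1 - ∫ x, g x ∂(vol Ω))) :
    ((ENNReal.ofReal (1 / 2 * (dualNorm p v).toReal ^ 2 * κ) * X ^ 2 : ℝ≥0∞) : EReal) ≤
      energy f (maximalPot p v) - energy f V := by
  have hvfin := dualNorm_lt_top_of_isMinimizerG hv
  have hc : 0 < (dualNorm p v).toReal := ENNReal.toReal_pos hv0.ne' hvfin.ne
  set c := (dualNorm p v).toReal with hcdef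
  have hg' : g = fun x => (c ^ 2)⁻¹ * ((V x).toReal * fnOf v x ^ 2) := by
    funext x
    rw [hg, toReal_maximalPot_rpow hp, div_pow, sq_abs]
    ring
  have hint := integrable_toReal_mul_sq hp hV.1 hpot hvfin
  have h1 := hX (by rw [hg']; exact hint.const_mul _)
  have h2 : 1 / 2 * c ^ 2 * (1 - ∫ x, g x ∂(vol Ω)) =
      1 / 2 * (c ^ 2 - ∫ x, (V x).toReal * fnOf v x ^ 2 ∂(vol Ω)) := by
    rw [hg', integral_const_mul]
    field_simp
  refine le_trans (EReal.coe_ennreal_le_coe_ennreal_iff.2 ?_)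
    (energy_gap hΩ hp hf hv hv0 hV hpot).2
  have hc2 : 0 ≤ 1 / 2 * c ^ 2 := by positivity
  rw [← hcdef, ← h2, ENNReal.ofReal_mul hc2, ENNReal.ofReal_mul hc2, mul_assoc]
  exact mul_le_mul_right h1 _

theorem toReal_maximalPot_nonneg (x : Eucl N) : 0 ≤ (maximalPot p v x).toReal := by
  rw [toReal_maximalPot]; exact optPot_nonneg ENNReal.toReal_nonneg x

theorem stability_of_lt_two (hΩ : IsOpen Ω) (hp : 1 < p) (hp2 : p < 2) (hf : MemDual f)
    (hv : IsMinimizerG p f v) (hv0 : 0 < dualNorm p v) (hV : Admissible Ω V)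
    (hpot : potNorm Ω p V ≤ 1) :
    ((ENNReal.ofReal (stabConst p (dualNorm p v).toReal) *
      eLpNorm (fun x => (V x).toReal - (maximalPot p v x).toReal)
        (ENNReal.ofReal p) (vol Ω) ^ 2 : ℝ≥0∞) : EReal) ≤
      energy f (maximalPot p v) - energy f V := by
  have hpot0 := (potNorm_maximalPot hp hv0 (dualNorm_lt_top_of_isMinimizerG hv)).le
  have hm0 := (admissible_maximalPot (p := p) (v := v)).1
  refine stability_of_bound hΩ hp hf hv hv0 hV hpot (fun x => ?_) fun hint =>
    quantitative_holder hp hp2.le (memLp_toReal hp hm0 hpot0) (memLp_toReal hp hV.1 hpot)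
      ((eLpNorm_toReal_eq_potNorm hp hm0 hpot0).trans_le hpot0)
      ((eLpNorm_toReal_eq_potNorm hp hV.1 hpot).trans_le hpot) hint
  rw [rpow_sub_two_mul_self hp (toReal_maximalPot_nonneg x)]

theorem stability_of_two_le (hΩ : IsOpen Ω) (hp : 1 < p) (hp2 : 2 ≤ p) (hf : MemDual f)
    (hv : IsMinimizerG p f v) (hv0 : 0 < dualNorm p v) (hV : Admissible Ω V)
    (hpot : potNorm Ω p V ≤ 1) :
    ((ENNReal.ofReal (stabConst (p / (p - 1)) (dualNorm p v).toReal) *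
      eLpNorm (fun x => |(V x).toReal| ^ (p - 2) * (V x).toReal
        - (maximalPot p v x).toReal ^ (p - 1))
        (ENNReal.ofReal (p / (p - 1))) (vol Ω) ^ 2 : ℝ≥0∞) : EReal) ≤
      energy f (maximalPot p v) - energy f V := by
  have hpot0 := (potNorm_maximalPot hp hv0 (dualNorm_lt_top_of_isMinimizerG hv)).le
  have hm0 := (admissible_maximalPot (p := p) (v := v)).1
  have hr2 : p / (p - 1) ≤ 2 := by rw [div_le_iff₀ (by linarith)]; linarith
  have hconj : ∀ {W : Eucl N → EReal} {a : Eucl N → ℝ}, Measurable W → potNorm Ω p W ≤ 1 →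
      (∀ x, |a x| = |(W x).toReal| ^ (p - 1)) →
      eLpNorm a (ENNReal.ofReal (p / (p - 1))) (vol Ω) ≤ 1 := fun hW hW1 ha => by
    rw [eLpNorm_conj_of_abs_eq hp ha, eLpNorm_toReal_eq_potNorm hp hW hW1]
    exact ENNReal.rpow_le_one hW1 (by linarith)
  have hb1 := hconj (a := fun x => (maximalPot p v x).toReal ^ (p - 1)) hm0 hpot0 fun x => by
    rw [abs_of_nonneg (Real.rpow_nonneg (toReal_maximalPot_nonneg x) _),
      abs_of_nonneg (toReal_maximalPot_nonneg x)]
  have ha1 := hconj (a := fun x => |(V x).toReal| ^ (p - 2) * (V x).toReal) hV.1 hpot fun x =>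
    abs_signed_rpow hp _
  have hVr : Measurable fun x => (V x).toReal := hV.1.ereal_toReal
  have hm : MemLp (fun x => |(V x).toReal| ^ (p - 2) * (V x).toReal)
      (ENNReal.ofReal (p / (p - 1))) (vol Ω) :=
    ⟨((hVr.abs.pow_const _).mul hVr).aestronglyMeasurable, ha1.trans_lt ENNReal.one_lt_top⟩
  have hm' : MemLp (fun x => (maximalPot p v x).toReal ^ (p - 1))
      (ENNReal.ofReal (p / (p - 1))) (vol Ω) :=
    ⟨(hm0.ereal_toReal.pow_const _).aestronglyMeasurable, hb1.trans_lt ENNReal.one_lt_top⟩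
  have hcomm : eLpNorm (fun x => |(V x).toReal| ^ (p - 2) * (V x).toReal
        - (maximalPot p v x).toReal ^ (p - 1)) (ENNReal.ofReal (p / (p - 1))) (vol Ω) =
      eLpNorm (fun x => (maximalPot p v x).toReal ^ (p - 1)
        - |(V x).toReal| ^ (p - 2) * (V x).toReal) (ENNReal.ofReal (p / (p - 1))) (vol Ω) :=
    eLpNorm_sub_comm _ _ _ _
  rw [hcomm]
  refine stability_of_bound hΩ hp hf hv hv0 hV hpot (fun x => ?_) fun hint =>
    quantitative_holder (one_lt_conj hp) hr2 hm hm' ha1 hb1 hint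
  rw [signed_rpow_conj hp, mul_comm]

/-- A potential with the energy of the optimal one coincides with it. -/
theorem ae_eq_maximalPot (hΩ : IsOpen Ω) (hp : 1 < p) (hf : MemDual f)
    (hv : IsMinimizerG p f v) (hv0 : 0 < dualNorm p v) (hV : Admissible Ω V)
    (hpot : potNorm Ω p V ≤ 1) (hE : energy f V = energy f (maximalPot p v)) :
    V =ᵐ[vol Ω] maximalPot p v := by
  have hvfin := dualNorm_lt_top_of_isMinimizerG hv
  have hc : 0 < (dualNorm p v).toReal := ENNReal.toReal_pos hv0.ne' hvfin.ne
  obtain ⟨hbot, htop⟩ := energy_ne_bot_and_ne_top hp hf hV hpot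
  have hVr : Measurable fun x => (V x).toReal := hV.1.ereal_toReal
  have hm0 : Measurable fun x => (maximalPot p v x).toReal :=
    (admissible_maximalPot (p := p) (v := v)).1.ereal_toReal
  have hzero : ∀ {κ : ℝ} {X : ℝ≥0∞}, 0 < κ → ((ENNReal.ofReal κ * X ^ 2 : ℝ≥0∞) : EReal) ≤
      energy f (maximalPot p v) - energy f V → X = 0 := fun hκ h => by
    rw [← hE, EReal.sub_self htop hbot] at h
    have h1 := EReal.coe_ennreal_le_coe_ennreal_iff.1 (h.trans_eq EReal.coe_ennreal_zero.symm)
    have h2 := (mul_eq_zero.1 (le_zero_iff.1 h1)).resolve_left (by simpa using hκ)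
    exact pow_eq_zero_iff two_ne_zero |>.1 h2
  have key : ∀ᵐ x ∂(vol Ω), (V x).toReal = (maximalPot p v x).toReal := by
    rcases lt_or_ge p 2 with hp2 | hp2
    · have h := hzero (stabConst_pos hp hc) (stability_of_lt_two hΩ hp hp2 hf hv hv0 hV hpot)
      have hmeas : Measurable fun x => (V x).toReal - (maximalPot p v x).toReal := hVr.sub hm0
      rw [eLpNorm_eq_zero_iff hmeas.aestronglyMeasurable (by simp; linarith)] at h
      filter_upwards [h] with x hx
      exact sub_eq_zero.1 hx
    · have hr := one_lt_conj hp
      have h := hzero (stabConst_pos hr hc) (stability_of_two_le hΩ hp hp2 hf hv hv0 hV hpot)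
      have hmeas : Measurable fun x => |(V x).toReal| ^ (p - 2) * (V x).toReal
          - (maximalPot p v x).toReal ^ (p - 1) :=
        ((hVr.abs.pow_const _).mul hVr).sub (hm0.pow_const _)
      rw [eLpNorm_eq_zero_iff hmeas.aestronglyMeasurable (by
        simp only [ne_eq, ENNReal.ofReal_eq_zero, not_le]; linarith)] at h
      filter_upwards [h] with x hx
      have hx' := sub_eq_zero.1 hx
      have h0 := toReal_maximalPot_nonneg (p := p) (v := v) x
      rw [← rpow_sub_two_mul_self hp h0] at hx'
      rw [← signed_rpow_conj hp (V x).toReal, hx', signed_rpow_conj hp]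
  filter_upwards [key, ae_coe_toReal_eq hp hV.1 hpot] with x h1 h2
  rw [← h2, h1, toReal_maximalPot, maximalPot]

end

end SchrodingerPotential

end

open SchrodingerPotential
theorem theorem4p3 :
    ∃ σ₁ σ₂ : ℝ → ℝ → ℝ,
      (∀ p c : ℝ, 1 < p → 0 < c → 0 < σ₁ p c ∧ 0 < σ₂ p c) ∧
      ∀ (N : ℕ) [Fact (3 ≤ N)] (Ω : Set (Eucl N)) (_ : IsOpen Ω)
        (f : W012 Ω →ₗ[ℝ] ℝ) (_ : MemDual f) (_ : f ≠ 0) (p : ℝ) (_ : 1 < p),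
        (∃! v₀ : W012 Ω, IsMinimizerG p f v₀) ∧
        (∃ V₀ : Eucl N → EReal, IsMaximalPotential p f V₀) ∧
        ∀ (v₀ : W012 Ω) (V₀ : Eucl N → EReal), IsMinimizerG p f v₀ → IsMaximalPotential p f V₀ →
          (0 < dualNorm p v₀ ∧ dualNorm p v₀ < ∞) ∧
          (∀ᵐ x ∂(vol Ω), 0 ≤ V₀ x) ∧
          (∀ V : Eucl N → EReal, IsMaximalPotential p f V → V =ᵐ[vol Ω] V₀) ∧
          ∀ V : Eucl N → EReal, Admissible Ω V → potNorm Ω p V ≤ 1 →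
            (energy f V ≠ ⊥ ∧ energy f V ≠ ⊤) ∧
            (2 ≤ p →
              ((ENNReal.ofReal (σ₁ p (dualNorm p v₀).toReal) *
                eLpNorm (fun x => |(V x).toReal| ^ (p - 2) * (V x).toReal
                    - (V₀ x).toReal ^ (p - 1))
                  (ENNReal.ofReal (p / (p - 1))) (vol Ω) ^ 2 : ℝ≥0∞) : EReal)
                ≤ energy f V₀ - energy f V) ∧
            (p < 2 →
              ((ENNReal.ofReal (σ₂ p (dualNorm p v₀).toReal) *
                eLpNorm (fun x => (V x).toReal - (V₀ x).toReal)
                  (ENNReal.ofReal p) (vol Ω) ^ 2 : ℝ≥0∞) : EReal)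
                ≤ energy f V₀ - energy f V) := by
  refine ⟨fun p c => stabConst (p / (p - 1)) c, stabConst,
    fun p c hp hc => ⟨stabConst_pos (one_lt_conj hp) hc, stabConst_pos hp hc⟩, ?_⟩
  intro N _ Ω hΩ f hf hf0 p hp
  have hmax : ∀ {v : W012 Ω}, IsMinimizerG p f v → IsMaximalPotential p f (maximalPot p v) :=
    fun {v} hv => by
      have hv0 := dualNorm_pos_of_isMinimizerG hΩ hp hf hf0 hv
      exact ⟨admissible_maximalPot,
        (potNorm_maximalPot hp hv0 (dualNorm_lt_top_of_isMinimizerG hv)).le,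
        fun V hV hpot => (energy_gap hΩ hp hf hv hv0 hV hpot).1⟩
  have hex := existsUnique_isMinimizerG hp hf
  refine ⟨hex, ?_, ?_⟩
  · obtain ⟨v, hv, -⟩ := hex
    exact ⟨_, hmax hv⟩
  intro v V₀ hv hV₀
  have hv0 := dualNorm_pos_of_isMinimizerG hΩ hp hf hf0 hv
  have hm := hmax hv
  have hE : ∀ {V : Eucl N → EReal}, IsMaximalPotential p f V →
      energy f V = energy f (maximalPot p v) := fun hV =>
    le_antisymm (hm.2.2 _ hV.1 hV.2.1) (hV.2.2 _ hm.1 hm.2.1)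
  have huniq : ∀ {V : Eucl N → EReal}, IsMaximalPotential p f V → V =ᵐ[vol Ω] maximalPot p v :=
    fun hV => ae_eq_maximalPot hΩ hp hf hv hv0 hV.1 hV.2.1 (hE hV)
  have hV₀eq := huniq hV₀
  refine ⟨⟨hv0, dualNorm_lt_top_of_isMinimizerG hv⟩, ?_,
    fun V hV => (huniq hV).trans hV₀eq.symm, fun V hV hpot =>
      ⟨energy_ne_bot_and_ne_top hp hf hV hpot, fun hp2 => ?_, fun hp2 => ?_⟩⟩
  · filter_upwards [hV₀eq] with x hx
    rw [hx]
    exact EReal.coe_nonneg.2 (optPot_nonneg ENNReal.toReal_nonneg x)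
  · rw [hE hV₀]
    refine le_of_eq_of_le ?_ (stability_of_two_le hΩ hp hp2 hf hv hv0 hV hpot)
    congr 3
    exact eLpNorm_congr_ae (by filter_upwards [hV₀eq] with x hx; rw [hx])
  · rw [hE hV₀]
    refine le_of_eq_of_le ?_ (stability_of_lt_two hΩ hp hp2 hf hv hv0 hV hpot)
    congr 3
    exact eLpNorm_congr_ae (by filter_upwards [hV₀eq] with x hx; rw [hx])
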